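/- Let $A\subseteq\mathbb{R}^2$ be a finite generic set (no three points collinear, no four points cocircular) with $n=|A|\ge 3$. For $I\subseteq A$ with $|I|=2$ write $[I]$ for the midpoint of the two points of $I$, and let $A^{(2)}=\{[I] : I\subseteq A,\ |I|=2\}$. A \emph{level-2 hypertriangulation} of $A$ is an edge-to-edge subdivision of $\operatorname{conv}A^{(2)}$ into triangles with vertices in $A^{(2)}$ (not all points of $A^{(2)}$ need be vertices), together with one label $I$ for each vertex $p$, where $I\subseteq A$, $|I|=2$ and $p=[I]$, such that every edge with endpoints labeled $I$ and $J$ satisfies $|I\cap J|=1$. It is \emph{maximal} if no level-2 hypertriangulation of $A$ properly subdivides it. A triangle with vertices labeled $I,J,K$ is \emph{black} if $|I\cap J\cap K|=0$ and \emph{white} if $|I\cap J\cap K|=1$. A level-2 hypertriangulation has the \emph{local angle property} if - (ww) for every edge shared by two white triangles, the sum of the two angles opposite the edge is at most $\pi$; - (bb) for every edge shared by two black triangles, the sum of the two angles opposite the edge is at least $\pi$; - (bw) for every edge shared by a black and a white triangle, the angle opposite the edge in the black triangle is bigger than the angle opposite the edge in the white triangle. The \emph{order-2 Delaunay triangulation}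 of $A$ is the set consisting of the black triangles with vertices labeled $\{a,b\},\{a,c\},\{b,c\}$ for all distinct $a,b,c\in A$ such that no point of $A$ lies inside the circumcircle of $abc$, and of the white triangles with vertices labeled $\{y,a\},\{y,b\},\{y,c\}$ for all distinct $a,b,c\in A$ and $y\in A$ such that $y$ is the only point of $A$ inside the circumcircle of $abc$. **Theorem.** Let $P_2$ be a maximal level-2 hypertriangulation of $A$. Then $P_2$ has the local angle property if and only if it is the order-2 Delaunay triangulation of $A$ (with the same labeled triangles). -/

import Mathlib

noncomputable section

namespace Hypertri

open scoped Classical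

/-- The Euclidean plane. -/
abbrev Plane : Type := EuclideanSpace ℝ (Fin 2)

/-- A finite planar set is generic if no three of its points are collinear and no four of them
are cocircular. -/
structure IsGeneric (A : Finset Plane) : Prop where
  not_collinear : ∀ a ∈ A, ∀ b ∈ A, ∀ c ∈ A, a ≠ b → a ≠ c → b ≠ c →
    ¬ Collinear ℝ ({a, b, c} : Set Plane)
  not_cocircular : ∀ a ∈ A, ∀ b ∈ A, ∀ c ∈ A, ∀ d ∈ A,
    a ≠ b → a ≠ c → a ≠ d → b ≠ c → b ≠ d → c ≠ d →
    ¬ EuclideanGeometry.Cospherical ({a, b, c, d} : Set Plane)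

/-- `T`, a set of triangles each given by its three vertices, is a (possibly partial)
triangulation of the point set `S`: an edge-to-edge subdivision of `conv S` into triangles with
vertices in `S`. -/
structure IsTriangulation (S : Set Plane) (T : Set (Finset Plane)) : Prop where
  vertices_subset : ∀ t ∈ T, (t : Set Plane) ⊆ S
  card_eq : ∀ t ∈ T, t.card = 3
  affineIndependent : ∀ t ∈ T, AffineIndependent ℝ (fun p : t => (p : Plane))
  cover : (⋃ t ∈ T, convexHull ℝ (t : Set Plane)) = convexHull ℝ S
  edge_to_edge : ∀ s ∈ T, ∀ t ∈ T,
    convexHull ℝ (s : Set Plane) ∩ convexHull ℝ (t : Set Plane) =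
      convexHull ℝ ((s : Set Plane) ∩ (t : Set Plane))

/-- For two triangulations of the same point set: `T'` subdivides `T` if every triangle of `T'`
lies in a triangle of `T`. -/
def Subdivides (T' T : Set (Finset Plane)) : Prop :=
  ∀ s ∈ T', ∃ t ∈ T, convexHull ℝ (s : Set Plane) ⊆ convexHull ℝ (t : Set Plane)

/-- The average `[I]` of the points in a label `I`. -/
def avg (I : Finset Plane) : Plane := (I.card : ℝ)⁻¹ • ∑ x ∈ I, x

/-- The set `A^(k)` of `k`-fold averages of the points in `A`. -/
def kAverages (A : Finset Plane) (k : ℕ) : Set Plane :=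
  {p | ∃ I : Finset Plane, I ⊆ A ∧ I.card = k ∧ avg I = p}

/-- The geometric triangles of a set of labeled triangles; a labeled triangle is given by the
set of the labels of its vertices. -/
def geometric (P : Set (Finset (Finset Plane))) : Set (Finset Plane) :=
  (fun t => t.image avg) '' P

/-- A level-`k` hypertriangulation of `A`, as a set of labeled triangles: the labels are
`k`-element subsets of `A`, each point that is used as a vertex carries only one label, the
triangles form a (possibly partial) triangulation of `A^(k)`, and the labels of the two endpoints
of every edge share exactly `k - 1` points. -/
structure IsHypertriangulation (A : Finset Plane) (k : ℕ)
    (P : Set (Finset (Finset Plane))) : Prop where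
  one_le : 1 ≤ k
  lt_card : k < A.card
  label_subset : ∀ t ∈ P, ∀ I ∈ t, I ⊆ A
  label_card : ∀ t ∈ P, ∀ I ∈ t, I.card = k
  label_unique : ∀ s ∈ P, ∀ t ∈ P, ∀ I ∈ s, ∀ J ∈ t, avg I = avg J → I = J
  isTriangulation : IsTriangulation (kAverages A k) (geometric P)
  edge : ∀ t ∈ P, ∀ I ∈ t, ∀ J ∈ t, I ≠ J → (I ∩ J).card + 1 = k

/-- A level-`k` hypertriangulation is maximal if it is not properly subdivided by a level-`k`
hypertriangulation of the same points. -/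
def IsMaximalHypertriangulation (A : Finset Plane) (k : ℕ)
    (P : Set (Finset (Finset Plane))) : Prop :=
  IsHypertriangulation A k P ∧
    ∀ Q : Set (Finset (Finset Plane)), IsHypertriangulation A k Q →
      Subdivides (geometric Q) (geometric P) → geometric Q = geometric P

/-- The level-`k` triangle with labels `I`, `J`, `K` is black: `|I ∩ J ∩ K| = k - 2`. -/
def IsBlack (k : ℕ) (I J K : Finset Plane) : Prop := (I ∩ J ∩ K).card + 2 = k

/-- The level-`k` triangle with labels `I`, `J`, `K` is white: `|I ∩ J ∩ K| = k - 1`. -/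
def IsWhite (k : ℕ) (I J K : Finset Plane) : Prop := (I ∩ J ∩ K).card + 1 = k

/-- The angle opposite to the edge `[I][J]` in the triangle `[I][J][K]`. -/
def oppositeAngle (I J K : Finset Plane) : ℝ :=
  EuclideanGeometry.angle (avg I) (avg K) (avg J)

/-- The local angle property of a level-`k` hypertriangulation `P`; in each condition, `[I][J]`
is an edge shared by the two triangles of `P` with third vertices `[K]` and `[L]`. -/
structure HasLocalAngleProperty (k : ℕ) (P : Set (Finset (Finset Plane))) : Prop where
  ww : ∀ I J K L : Finset Plane, {I, J, K} ∈ P → {I, J, L} ∈ P → K ≠ L →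
    IsWhite k I J K → IsWhite k I J L →
    oppositeAngle I J K + oppositeAngle I J L ≤ Real.pi
  bb : ∀ I J K L : Finset Plane, {I, J, K} ∈ P → {I, J, L} ∈ P → K ≠ L →
    IsBlack k I J K → IsBlack k I J L →
    Real.pi ≤ oppositeAngle I J K + oppositeAngle I J L
  bw : ∀ I J K L : Finset Plane, {I, J, K} ∈ P → {I, J, L} ∈ P →
    IsBlack k I J K → IsWhite k I J L →
    oppositeAngle I J L < oppositeAngle I J K

/-- The points of `A` inside the circle `S`. -/
def inside (A : Finset Plane) (S : EuclideanGeometry.Sphere Plane) : Finset Plane :=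
  A.filter (fun x => dist x S.center < S.radius)

/-- The order-`k` Delaunay triangulation of `A`, as a set of labeled triangles: for every circle
`S` through three points `a, b, c` of `A`, with `X` the set of points of `A` inside `S`, it
contains the black triangle `[Xab][Xac][Xbc]` if `|X| = k - 2` and the white triangle
`[Xa][Xb][Xc]` if `|X| = k - 1`. -/
def delaunay (A : Finset Plane) (k : ℕ) : Set (Finset (Finset Plane)) :=
  {t | ∃ a ∈ A, ∃ b ∈ A, ∃ c ∈ A, a ≠ b ∧ a ≠ c ∧ b ≠ c ∧
    ∃ S : EuclideanGeometry.Sphere Plane, a ∈ S ∧ b ∈ S ∧ c ∈ S ∧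
      (((inside A S).card + 2 = k ∧
          t = {inside A S ∪ {a, b}, inside A S ∪ {a, c}, inside A S ∪ {b, c}}) ∨
        ((inside A S).card + 1 = k ∧
          t = {inside A S ∪ {a}, inside A S ∪ {b}, inside A S ∪ {c}}))}

end Hypertri

end

noncomputable section

namespace Hypertri

open scoped Classical

/-! Everything is expressed through the power `pw a b c d` of a point `d` with respect to the circle
`abc`. A black triangle is the medial triangle of `abc`, a white one is a half-size copy of `abc`,
so opposite angles at level 2 are angles of triangles spanned by `A`. The condition (ww) says that
neighboring white triangles have mutually non-enclosing circles; (bw), for a black `yab` next to a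
white triangle with common point `y` and circle `abz`, says that `z` is outside the circle `aby`,
equivalently that `y` is inside the circle `abz`.

From local to global: fix `d` and take a triangle with least `pw a b c d` among the black ones and
the white ones whose common point is not `d`. If that power were negative, some edge could be
crossed to a triangle of the same kind with smaller power: two circles through `a` and `b` differ in
power by a multiple of the signed distance to the line `ab`, and the local conditions fix the sign.
The only obstruction is a white triangle with `d` inside `abc`; maximality excludes it, since the
point `[yd]` would subdivide that triangle (`IsMaximalHypertriangulation.whiteEmpty`). Hence
`HasLocalAngleProperty.pw_nonneg`. A dual argument, maximizing the power of `y` over the white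
triangles with common point `y`, puts `y` inside their circles
(`HasLocalAngleProperty.pw_center_neg`). So every triangle of the hypertriangulation is an order-2
Delaunay triangle.

Equality follows because Delaunay triangles lift to lower faces of a convex hull and so cannot
overlap (`delaunay_eq_of_centroid_mem`), while the given triangles already cover `conv A^(2)`. The
converse reads the angle inequalities off the signs of the powers. -/

/-! ### Signed areas and powers of points in coordinates -/

/-- Twice the signed area of the triangle `abc`. -/
def orient (a b c : Plane) : ℝ := (b 0 - a 0) * (c 1 - a 1) - (b 1 - a 1) * (c 0 - a 0)

/-- The inner product of `a - c` and `b - c`. -/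
def dotAt (c a b : Plane) : ℝ := (a 0 - c 0) * (b 0 - c 0) + (a 1 - c 1) * (b 1 - c 1)

/-- The power of `x` with respect to the circle through `a`, `b`, `c`. -/
def pw (a b c x : Plane) : ℝ := dotAt x a b - orient a b x / orient a b c * dotAt c a b

lemma orient_swap (a b c : Plane) : orient b a c = -orient a b c := by unfold orient; ring

lemma orient_rotate (a b c : Plane) : orient b c a = orient a b c := by unfold orient; ring

lemma orient_swap' (a b c : Plane) : orient a c b = -orient a b c := by unfold orient; ring

lemma orient_combo (p q x y : Plane) {α β : ℝ} (h : α + β = 1) :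
    orient p q (α • x + β • y) = α * orient p q x + β * orient p q y := by
  obtain rfl : β = 1 - α := by linarith
  simp only [orient, PiLp.add_apply, PiLp.smul_apply, smul_eq_mul]; ring

lemma orient_combo₃ (p q x y z : Plane) {α β γ : ℝ} (h : α + β + γ = 1) :
    orient p q (α • x + β • y + γ • z) =
      α * orient p q x + β * orient p q y + γ * orient p q z := by
  obtain rfl : γ = 1 - α - β := by linarith
  simp only [orient, PiLp.add_apply, PiLp.smul_apply, smul_eq_mul]; ring

@[simp] lemma orient_left (p q : Plane) : orient p q p = 0 := by unfold orient; ring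

@[simp] lemma orient_right (p q : Plane) : orient p q q = 0 := by unfold orient; ring

lemma pw_swap (a b c x : Plane) : pw b a c x = pw a b c x := by
  unfold pw
  rw [orient_swap a b c, orient_swap a b x, neg_div_neg_eq]
  unfold dotAt; ring

lemma pw_swap' {a b c : Plane} (h : orient a b c ≠ 0) (x : Plane) : pw a c b x = pw a b c x := by
  unfold pw
  rw [orient_swap' a b c, div_neg]
  field_simp
  unfold dotAt orient; ring

/-- Circles through `a` and `b` form a pencil, so two of their power functions differ by a multiple
of the equation of the line `ab`. This controls how the power changes when an edge is crossed. -/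
lemma pw_sub (a b c z x : Plane) :
    pw a b c x - pw a b z x =
      orient a b x * (dotAt z a b / orient a b z - dotAt c a b / orient a b c) := by
  unfold pw; ring

lemma pw_mul {a b c : Plane} (h : orient a b c ≠ 0) (x : Plane) :
    orient a b c * pw a b c x =
      orient a b c * dotAt x a b - orient a b x * dotAt c a b := by
  unfold pw; field_simp

lemma pw_eq_mul {a b c x : Plane} (h : orient a b x ≠ 0) :
    pw a b c x = orient a b x * (dotAt x a b / orient a b x - dotAt c a b / orient a b c) := by
  unfold pw; field_simp

lemma plane_ext {a b : Plane} (h0 : a 0 = b 0) (h1 : a 1 = b 1) : a = b := by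
  ext i; fin_cases i <;> assumption

lemma dist_sq (x y : Plane) : dist x y ^ 2 = (x 0 - y 0) ^ 2 + (x 1 - y 1) ^ 2 := by
  rw [EuclideanSpace.dist_eq, Real.sq_sqrt (by positivity)]
  simp [Fin.sum_univ_two, Real.dist_eq, sq_abs]

lemma collinear_of_orient_eq_zero {a b c : Plane} (hab : a ≠ b) (h : orient a b c = 0) :
    Collinear ℝ ({a, b, c} : Set Plane) := by
  rw [collinear_iff_of_mem (p₀ := a) (by simp)]
  have hN : (b 0 - a 0) ^ 2 + (b 1 - a 1) ^ 2 ≠ 0 := by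
    rw [← dist_sq]
    have := dist_pos.2 hab.symm
    positivity
  refine ⟨b - a, fun p hp => ?_⟩
  simp only [Set.mem_insert_iff, Set.mem_singleton_iff] at hp
  unfold orient at h
  rcases hp with rfl | rfl | rfl
  · exact ⟨0, by simp⟩
  · exact ⟨1, by simp⟩
  · refine ⟨((p 0 - a 0) * (b 0 - a 0) + (p 1 - a 1) * (b 1 - a 1)) /
      ((b 0 - a 0) ^ 2 + (b 1 - a 1) ^ 2), ?_⟩
    apply plane_ext
    · simp only [vadd_eq_add, PiLp.add_apply, PiLp.smul_apply, PiLp.sub_apply, smul_eq_mul]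
      field_simp
      linear_combination (-(b 1 - a 1)) * h
    · simp only [vadd_eq_add, PiLp.add_apply, PiLp.smul_apply, PiLp.sub_apply, smul_eq_mul]
      field_simp
      linear_combination (b 0 - a 0) * h

lemma not_collinear_of_orient_ne_zero {a b c : Plane} (h : orient a b c ≠ 0) :
    ¬ Collinear ℝ ({a, b, c} : Set Plane) := by
  intro hc
  rw [collinear_iff_of_mem (p₀ := a) (by simp)] at hc
  obtain ⟨v, hv⟩ := hc
  obtain ⟨s, hs⟩ := hv b (by simp)
  obtain ⟨t, ht⟩ := hv c (by simp)
  apply h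
  unfold orient
  rw [hs, ht]
  simp only [vadd_eq_add, PiLp.add_apply, PiLp.smul_apply, smul_eq_mul]
  ring

lemma affineIndependent_of_orient_ne_zero {a b c : Plane} (h : orient a b c ≠ 0) :
    AffineIndependent ℝ (fun p : ({a, b, c} : Finset Plane) => (p : Plane)) := by
  have h1 := (affineIndependent_iff_not_collinear_set.2 (not_collinear_of_orient_ne_zero h)).range
  have h2 : Set.range ![a, b, c] = (({a, b, c} : Finset Plane) : Set Plane) := by
    ext x
    simp [eq_comm]
    tauto
  rw [h2] at h1
  exact h1

lemma ne_of_orient_ne_zero {a b c : Plane} (h : orient a b c ≠ 0) : a ≠ b ∧ a ≠ c ∧ b ≠ c := by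
  refine ⟨?_, ?_, ?_⟩ <;> rintro rfl <;> apply h <;> unfold orient <;> ring

/-- Both sides have the same quadratic part, so they differ by an affine function, which is
determined by its values at three non-collinear points. The multipliers are the unnormalized
barycentric coordinates of `x`. -/
lemma eq_pw_of_eq_zero {a b c : Plane} (h : orient a b c ≠ 0) {u v w : ℝ}
    (ha : a 0 ^ 2 + a 1 ^ 2 + u * a 0 + v * a 1 + w = 0)
    (hb : b 0 ^ 2 + b 1 ^ 2 + u * b 0 + v * b 1 + w = 0)
    (hc : c 0 ^ 2 + c 1 ^ 2 + u * c 0 + v * c 1 + w = 0) (x : Plane) :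
    x 0 ^ 2 + x 1 ^ 2 + u * x 0 + v * x 1 + w = pw a b c x := by
  apply mul_left_cancel₀ h
  rw [pw_mul h]
  linear_combination (norm := skip)
    (orient x b c) * ha + (orient a x c) * hb + (orient a b x) * hc
  unfold orient dotAt
  ring

lemma sphere_power {a b c : Plane} (h : orient a b c ≠ 0) {S : EuclideanGeometry.Sphere Plane}
    (ha : a ∈ S) (hb : b ∈ S) (hc : c ∈ S) (x : Plane) :
    dist x S.center ^ 2 - S.radius ^ 2 = pw a b c x := by
  rw [EuclideanGeometry.mem_sphere] at ha hb hc
  replace ha := congrArg (· ^ 2) ha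
  replace hb := congrArg (· ^ 2) hb
  replace hc := congrArg (· ^ 2) hc
  simp only [dist_sq] at ha hb hc ⊢
  rw [← eq_pw_of_eq_zero h (u := -2 * S.center 0) (v := -2 * S.center 1)
    (w := S.center 0 ^ 2 + S.center 1 ^ 2 - S.radius ^ 2) (by linarith) (by linarith)
    (by linarith)]
  ring

lemma exists_sphere {a b c : Plane} (h : orient a b c ≠ 0) :
    ∃ S : EuclideanGeometry.Sphere Plane, a ∈ S ∧ b ∈ S ∧ c ∈ S ∧ 0 ≤ S.radius := by
  set n : Plane → ℝ := fun x => x 0 ^ 2 + x 1 ^ 2 with hn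
  -- The circumcenter, from Cramer's rule applied to the equations of the perpendicular bisectors.
  set o : Plane := !₂[(n a * (b 1 - c 1) + n b * (c 1 - a 1) + n c * (a 1 - b 1)) /
      (2 * orient a b c),
    (n a * (c 0 - b 0) + n b * (a 0 - c 0) + n c * (b 0 - a 0)) / (2 * orient a b c)] with ho
  have key : ∀ x y : Plane, n x - n y = 2 * ((x 0 - y 0) * o 0 + (x 1 - y 1) * o 1) →
      dist x o = dist y o := by
    intro x y hxy
    rw [← abs_of_nonneg (dist_nonneg (x := x) (y := o)), ← abs_of_nonneg
      (dist_nonneg (x := y) (y := o)), ← sq_eq_sq_iff_abs_eq_abs, dist_sq, dist_sq]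
    simp only [hn] at hxy
    linear_combination hxy
  refine ⟨⟨o, dist a o⟩, ?_, ?_, ?_, dist_nonneg⟩
  · simp [EuclideanGeometry.mem_sphere]
  · rw [EuclideanGeometry.mem_sphere]
    apply key
    simp only [ho, PiLp.toLp_apply, Matrix.cons_val_zero, Matrix.cons_val_one]
    field_simp
    unfold orient; ring
  · rw [EuclideanGeometry.mem_sphere]
    apply key
    simp only [ho, PiLp.toLp_apply, Matrix.cons_val_zero, Matrix.cons_val_one]
    field_simp
    unfold orient; ring

lemma IsGeneric.orient_ne_zero {A : Finset Plane} (hA : IsGeneric A) {a b c : Plane} (ha : a ∈ A)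
    (hb : b ∈ A) (hc : c ∈ A) (hab : a ≠ b) (hac : a ≠ c) (hbc : b ≠ c) : orient a b c ≠ 0 :=
  fun h => hA.not_collinear a ha b hb c hc hab hac hbc (collinear_of_orient_eq_zero hab h)

lemma IsGeneric.pw_ne_zero {A : Finset Plane} (hA : IsGeneric A) {a b c d : Plane} (ha : a ∈ A)
    (hb : b ∈ A) (hc : c ∈ A) (hd : d ∈ A) (hab : a ≠ b) (hac : a ≠ c) (had : a ≠ d)
    (hbc : b ≠ c) (hbd : b ≠ d) (hcd : c ≠ d) : pw a b c d ≠ 0 := by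
  intro h
  have ho := hA.orient_ne_zero ha hb hc hab hac hbc
  obtain ⟨S, hSa, hSb, hSc, hr⟩ := exists_sphere ho
  apply hA.not_cocircular a ha b hb c hc d hd hab hac had hbc hbd hcd
  refine ⟨S.center, S.radius, ?_⟩
  have hSd : dist d S.center = S.radius := by
    have := sphere_power ho hSa hSb hSc d
    rw [h, sub_eq_zero, sq_eq_sq_iff_abs_eq_abs, abs_of_nonneg dist_nonneg, abs_of_nonneg hr]
      at this
    exact this
  rintro p (rfl | rfl | rfl | rfl)
  exacts [hSa, hSb, hSc, hSd]

/-! ### Angles in terms of signed areas and inner products -/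

/-- With `N` the product of the two side lengths, cosine and sine become polynomial up to an
absolute value. Sums and differences of angles are then compared through the sign of one sine. -/
lemma exists_mul_cos_sin_angle {a b c : Plane} (h : orient a b c ≠ 0) :
    ∃ N : ℝ, 0 < N ∧ N * Real.cos (EuclideanGeometry.angle a c b) = dotAt c a b ∧
      N * Real.sin (EuclideanGeometry.angle a c b) = |orient a b c| := by
  obtain ⟨-, hac, hbc⟩ := ne_of_orient_ne_zero h
  refine ⟨‖a - c‖ * ‖b - c‖, mul_pos (norm_pos_iff.2 (sub_ne_zero.2 hac))
    (norm_pos_iff.2 (sub_ne_zero.2 hbc)), ?_, ?_⟩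
  · rw [mul_comm, EuclideanGeometry.angle, vsub_eq_sub, vsub_eq_sub,
      InnerProductGeometry.cos_angle_mul_norm_mul_norm]
    simp [PiLp.inner_apply, Fin.sum_univ_two, dotAt]; ring
  · rw [mul_comm, EuclideanGeometry.angle, vsub_eq_sub, vsub_eq_sub,
      InnerProductGeometry.sin_angle_mul_norm_mul_norm, ← Real.sqrt_sq_eq_abs]
    congr 1
    simp only [PiLp.inner_apply, Fin.sum_univ_two, orient, PiLp.sub_apply, RCLike.inner_apply,
      conj_trivial]
    ring

lemma angle_mem_Ioo {a b c : Plane} (h : orient a b c ≠ 0) :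
    EuclideanGeometry.angle a c b ∈ Set.Ioo 0 Real.pi := by
  obtain ⟨N, hN, -, hs⟩ := exists_mul_cos_sin_angle h
  have hpos : 0 < Real.sin (EuclideanGeometry.angle a c b) := by
    have : 0 < |orient a b c| := abs_pos.2 h
    rw [← hs] at this
    exact (mul_pos_iff_of_pos_left hN).1 this
  refine ⟨(EuclideanGeometry.angle_nonneg a c b).lt_of_ne ?_,
    (EuclideanGeometry.angle_le_pi a c b).lt_of_ne ?_⟩ <;> intro h0
  · rw [← h0] at hpos; simp at hpos
  · rw [h0] at hpos; simp at hpos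

/-- Comparing an angle sum with `π`, in terms of coordinates. -/
lemma angle_add_le_pi_iff {a b c d : Plane} (hc : orient a b c ≠ 0) (hd : orient a b d ≠ 0) :
    EuclideanGeometry.angle a c b + EuclideanGeometry.angle a d b ≤ Real.pi ↔
      0 ≤ |orient a b c| * dotAt d a b + |orient a b d| * dotAt c a b := by
  obtain ⟨N, hN, hNc, hNs⟩ := exists_mul_cos_sin_angle hc
  obtain ⟨M, hM, hMc, hMs⟩ := exists_mul_cos_sin_angle hd
  obtain ⟨h1, h2⟩ := angle_mem_Ioo hc
  obtain ⟨h3, h4⟩ := angle_mem_Ioo hd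
  have key : |orient a b c| * dotAt d a b + |orient a b d| * dotAt c a b = N * M *
      Real.sin (EuclideanGeometry.angle a c b + EuclideanGeometry.angle a d b) := by
    rw [Real.sin_add, ← hNc, ← hNs, ← hMc, ← hMs]; ring
  rw [key, mul_nonneg_iff_of_pos_left (mul_pos hN hM)]
  constructor
  · intro h
    exact Real.sin_nonneg_of_nonneg_of_le_pi (by linarith) h
  · intro h
    by_contra! hlt
    have := Real.sin_neg_of_neg_of_neg_pi_lt (x := EuclideanGeometry.angle a c b +
      EuclideanGeometry.angle a d b - 2 * Real.pi) (by linarith) (by linarith)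
    rw [Real.sin_sub_two_pi] at this
    linarith

/-- Comparing two angles, in terms of coordinates. -/
lemma angle_lt_angle_iff {a b c d : Plane} (hc : orient a b c ≠ 0) (hd : orient a b d ≠ 0) :
    EuclideanGeometry.angle a d b < EuclideanGeometry.angle a c b ↔
      0 < |orient a b c| * dotAt d a b - |orient a b d| * dotAt c a b := by
  obtain ⟨N, hN, hNc, hNs⟩ := exists_mul_cos_sin_angle hc
  obtain ⟨M, hM, hMc, hMs⟩ := exists_mul_cos_sin_angle hd
  obtain ⟨h1, h2⟩ := angle_mem_Ioo hc
  obtain ⟨h3, h4⟩ := angle_mem_Ioo hd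
  have key : |orient a b c| * dotAt d a b - |orient a b d| * dotAt c a b = N * M *
      Real.sin (EuclideanGeometry.angle a c b - EuclideanGeometry.angle a d b) := by
    rw [Real.sin_sub, ← hNc, ← hNs, ← hMc, ← hMs]; ring
  rw [key, mul_pos_iff_of_pos_left (mul_pos hN hM)]
  constructor
  · intro h
    exact Real.sin_pos_of_pos_of_lt_pi (by linarith) (by linarith)
  · intro h
    by_contra! hlt
    have := Real.sin_nonpos_of_nonpos_of_neg_pi_le (x := EuclideanGeometry.angle a c b -
      EuclideanGeometry.angle a d b) (by linarith) (by linarith)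
    linarith

/-! ### Triangles as convex hulls and as intersections of half-planes -/

lemma mem_convexHull_triple {p q r x : Plane} : x ∈ convexHull ℝ ({p, q, r} : Set Plane) ↔
    ∃ α β γ : ℝ, 0 ≤ α ∧ 0 ≤ β ∧ 0 ≤ γ ∧ α + β + γ = 1 ∧ x = α • p + β • q + γ • r := by
  constructor
  · intro hx
    have hsub : convexHull ℝ ({p, q, r} : Set Plane) ⊆ {x | ∃ α β γ : ℝ, 0 ≤ α ∧ 0 ≤ β ∧ 0 ≤ γ ∧
        α + β + γ = 1 ∧ x = α • p + β • q + γ • r} := by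
      apply convexHull_min
      · rintro x (rfl | rfl | rfl)
        · exact ⟨1, 0, 0, by simp⟩
        · exact ⟨0, 1, 0, by simp⟩
        · exact ⟨0, 0, 1, by simp⟩
      · rintro x ⟨α, β, γ, h1, h2, h3, h4, rfl⟩ y ⟨α', β', γ', h1', h2', h3', h4', rfl⟩ a b ha hb hab
        refine ⟨a * α + b * α', a * β + b * β', a * γ + b * γ', by positivity, by positivity,
          by positivity, ?_, ?_⟩
        · linear_combination a * h4 + b * h4' + hab
        · module
    exact hsub hx
  · rintro ⟨α, β, γ, h1, h2, h3, h4, rfl⟩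
    have := (convex_convexHull ℝ ({p, q, r} : Set Plane)).sum_mem (t := (Finset.univ : Finset (Fin 3)))
      (w := ![α, β, γ]) (z := ![p, q, r]) (by simp [Fin.forall_fin_succ, h1, h2, h3])
      (by simp [Fin.sum_univ_three, h4])
      (by
        intro i _
        apply subset_convexHull
        fin_cases i <;> simp)
    simpa [Fin.sum_univ_three] using this

lemma orient_mul_nonneg_of_mem_convexHull {s : Set Plane} {p q : Plane} {k : ℝ}
    (h : ∀ x ∈ s, 0 ≤ k * orient p q x) {x : Plane} (hx : x ∈ convexHull ℝ s) :
    0 ≤ k * orient p q x := by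
  have hsub : convexHull ℝ s ⊆ {x | 0 ≤ k * orient p q x} := by
    apply convexHull_min h
    intro x hx y hy a b ha hb hab
    replace hx : 0 ≤ k * orient p q x := hx
    replace hy : 0 ≤ k * orient p q y := hy
    change 0 ≤ k * orient p q _
    rw [orient_combo _ _ _ _ hab, mul_add, mul_left_comm, mul_left_comm k]
    positivity
  exact hsub hx

lemma orient_eq_zero_of_mem_convexHull {s : Set Plane} {p q : Plane}
    (h : ∀ x ∈ s, orient p q x = 0) {x : Plane} (hx : x ∈ convexHull ℝ s) :
    orient p q x = 0 := by
  have h1 := orient_mul_nonneg_of_mem_convexHull (k := 1) (p := p) (q := q)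
    (fun y hy => by rw [h y hy, mul_zero]) hx
  have h2 := orient_mul_nonneg_of_mem_convexHull (k := -1) (p := p) (q := q)
    (fun y hy => by rw [h y hy, mul_zero]) hx
  linarith

lemma orient_sum (p q r x : Plane) :
    orient q r x + orient r p x + orient p q x = orient p q r := by
  unfold orient; ring

/-- The barycentric coordinates of `x` are quotients of signed areas; multiplying by `orient p q r`
makes the criterion independent of the orientation of the triangle. -/
lemma mem_convexHull_iff_orient {p q r x : Plane} (h : orient p q r ≠ 0) :
    x ∈ convexHull ℝ ({p, q, r} : Set Plane) ↔ 0 ≤ orient p q r * orient p q x ∧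
      0 ≤ orient p q r * orient q r x ∧ 0 ≤ orient p q r * orient r p x := by
  have hD : 0 < orient p q r * orient p q r := mul_self_pos.2 h
  constructor
  · intro hx
    refine ⟨?_, ?_, ?_⟩ <;> refine orient_mul_nonneg_of_mem_convexHull ?_ hx <;>
      rintro y (h | h | h) <;> rw [h] <;>
      first
      | exact hD.le
      | (rw [orient_rotate p q r]; exact hD.le)
      | (rw [orient_rotate q r p, orient_rotate p q r]; exact hD.le)
      | rw [orient_left, mul_zero]
      | rw [orient_right, mul_zero]
  · rintro ⟨h1, h2, h3⟩
    have aux : ∀ u : ℝ, 0 ≤ orient p q r * u → 0 ≤ u / orient p q r := by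
      intro u hu
      have : u / orient p q r = orient p q r * u / (orient p q r * orient p q r) := by
        field_simp
      rw [this]; positivity
    refine mem_convexHull_triple.2 ⟨_, _, _, aux _ h2, aux _ h3, aux _ h1, ?_, ?_⟩
    · rw [← add_div, ← add_div, orient_sum, div_self h]
    · apply plane_ext <;>
      · simp only [PiLp.add_apply, PiLp.smul_apply, smul_eq_mul]
        field_simp
        unfold orient; ring

lemma convexHull_inter_subset_iff {s t : Set Plane} :
    convexHull ℝ s ∩ convexHull ℝ t = convexHull ℝ (s ∩ t) ↔
      ∀ x, x ∈ convexHull ℝ s → x ∈ convexHull ℝ t → x ∈ convexHull ℝ (s ∩ t) := by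
  refine ⟨fun h x hs ht => h ▸ ⟨hs, ht⟩, fun h => Set.Subset.antisymm (fun x hx => h x hx.1 hx.2) ?_⟩
  exact Set.subset_inter (convexHull_mono Set.inter_subset_left)
    (convexHull_mono Set.inter_subset_right)

/-! ### Neighbors in a triangulation -/

/-- Beyond an edge that is not on the boundary there is another triangle. -/
lemma IsTriangulation.exists_neighbor {S : Set Plane} {T : Set (Finset Plane)}
    (hT : IsTriangulation S T) (hfin : T.Finite) {p q r m : Plane} (hs : {p, q, r} ∈ T)
    (hm : m ∈ convexHull ℝ S) (hneg : orient p q m * orient p q r < 0) :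
    ∃ l, {p, q, l} ∈ T ∧ orient p q l * orient p q r < 0 := by
  have hD : orient p q r ≠ 0 := by rintro h; simp [h] at hneg
  have hS : ∀ t ∈ T, convexHull ℝ (t : Set Plane) ⊆ convexHull ℝ S :=
    fun t ht => convexHull_mono (hT.vertices_subset t ht)
  set e : Plane := (1 / 2 : ℝ) • p + (1 / 2 : ℝ) • q with he
  have hes : e ∈ convexHull ℝ ((({p, q, r} : Finset Plane)) : Set Plane) := by
    rw [Finset.coe_insert, Finset.coe_insert, Finset.coe_singleton, mem_convexHull_triple]
    exact ⟨1 / 2, 1 / 2, 0, by norm_num, by norm_num, le_rfl, by norm_num, by simp [he]⟩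
  -- The triangles missing the edge midpoint `e` form a closed set, so a point close enough to `e`
  -- in the direction of `m` lies only in triangles containing `e`.
  set U : Set Plane := ⋃ t ∈ {t ∈ T | e ∉ convexHull ℝ (t : Set Plane)},
    convexHull ℝ (t : Set Plane) with hU
  have hUc : IsClosed U := by
    apply Set.Finite.isClosed_biUnion (hfin.subset (Set.sep_subset _ _))
    intro t _
    exact (t.finite_toSet.isCompact_convexHull ℝ).isClosed
  have heU : e ∈ Uᶜ := by
    simp only [hU, Set.mem_compl_iff, Set.mem_iUnion, not_exists]
    intro t ht
    exact ht.2
  have hcont : Continuous fun ε : ℝ => (1 - ε) • e + ε • m := by fun_prop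
  have hev : ∀ᶠ ε in nhdsWithin (0 : ℝ) (Set.Ioi 0), (1 - ε) • e + ε • m ∈ Uᶜ := by
    apply Filter.Eventually.filter_mono nhdsWithin_le_nhds
    apply hcont.continuousAt.eventually_mem
    apply hUc.isOpen_compl.mem_nhds
    simpa using heU
  obtain ⟨ε, hεU, hε0, hε1⟩ := (hev.and (Ioo_mem_nhdsGT (zero_lt_one' ℝ))).exists
  set x : Plane := (1 - ε) • e + ε • m with hx
  have hxS : x ∈ convexHull ℝ S :=
    convex_convexHull ℝ S (hS _ hs hes) hm (by linarith) hε0.le (by ring)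
  rw [← hT.cover] at hxS
  simp only [Set.mem_iUnion] at hxS
  obtain ⟨t, ht, hxt⟩ := hxS
  have het : e ∈ convexHull ℝ (t : Set Plane) := by
    by_contra h
    apply hεU
    simp only [hU, Set.mem_iUnion]
    exact ⟨t, ⟨ht, h⟩, hxt⟩
  have hest := convexHull_inter_subset_iff.1 (hT.edge_to_edge _ hs _ ht) e hes het
  have hoe : orient p q e = 0 := by rw [he, orient_combo _ _ _ _ (by norm_num)]; simp
  have hpt : p ∈ t := by
    by_contra hpt
    have := orient_eq_zero_of_mem_convexHull (p := q) (q := r) (fun y hy => by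
      obtain ⟨hy1, hy2⟩ := hy
      simp only [Finset.coe_insert, Finset.coe_singleton] at hy1
      rcases hy1 with rfl | rfl | rfl
      · exact absurd hy2 hpt
      · simp
      · simp) hest
    rw [he, orient_combo _ _ _ _ (by norm_num), orient_rotate] at this
    simp [hD] at this
  have hqt : q ∈ t := by
    by_contra hqt
    have := orient_eq_zero_of_mem_convexHull (p := r) (q := p) (fun y hy => by
      obtain ⟨hy1, hy2⟩ := hy
      simp only [Finset.coe_insert, Finset.coe_singleton] at hy1
      rcases hy1 with rfl | rfl | rfl
      · simp
      · exact absurd hy2 hqt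
      · simp) hest
    rw [he, orient_combo _ _ _ _ (by norm_num), orient_rotate q r p, orient_rotate p q r] at this
    simp [hD] at this
  have hpq : p ≠ q := (ne_of_orient_ne_zero hD).1
  obtain ⟨l, hl⟩ : ∃ l, (t.erase p).erase q = {l} := by
    rw [← Finset.card_eq_one, Finset.card_erase_of_mem (Finset.mem_erase.2 ⟨hpq.symm, hqt⟩),
      Finset.card_erase_of_mem hpt, hT.card_eq t ht]
  have htl : t = {p, q, l} := by
    rw [← hl, Finset.insert_erase (Finset.mem_erase.2 ⟨hpq.symm, hqt⟩), Finset.insert_erase hpt]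
  refine ⟨l, htl ▸ ht, ?_⟩
  by_contra! hge
  have := orient_mul_nonneg_of_mem_convexHull (k := orient p q r) (p := p) (q := q) (fun y hy => by
      rw [htl] at hy
      simp only [Finset.coe_insert, Finset.coe_singleton] at hy
      rcases hy with rfl | rfl | rfl
      · simp
      · simp
      · linarith) hxt
  rw [hx, orient_combo _ _ _ _ (by ring), hoe] at this
  nlinarith

/-! ### Subdividing a triangle by an interior point -/

/-- The point `m` lies in the interior of the triangle `pqr`. -/
def StrictlyInside (p q r m : Plane) : Prop :=
  0 < orient p q r * orient p q m ∧ 0 < orient p q r * orient q r m ∧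
    0 < orient p q r * orient r p m

lemma StrictlyInside.rotate {p q r m : Plane} (h : StrictlyInside p q r m) :
    StrictlyInside q r p m := by
  unfold StrictlyInside at *
  rw [orient_rotate p q r]
  exact ⟨h.2.1, h.2.2, h.1⟩

lemma StrictlyInside.orient_ne_zero {p q r m : Plane} (h : StrictlyInside p q r m) :
    orient p q r ≠ 0 := by
  intro h0; have := h.1; simp [h0] at this

lemma StrictlyInside.mem_convexHull {p q r m : Plane} (h : StrictlyInside p q r m) :
    m ∈ convexHull ℝ ({p, q, r} : Set Plane) :=
  (mem_convexHull_iff_orient h.orient_ne_zero).2 ⟨h.1.le, h.2.1.le, h.2.2.le⟩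

lemma triple_rotate {α : Type*} [DecidableEq α] (p q r : α) : ({q, r, p} : Finset α) = {p, q, r} := by
  ext x; simp; tauto

lemma StrictlyInside.convexHull_subset {p q r m : Plane} (h : StrictlyInside p q r m) :
    convexHull ℝ ({p, q, m} : Set Plane) ⊆ convexHull ℝ ({p, q, r} : Set Plane) := by
  apply convexHull_min _ (convex_convexHull _ _)
  rintro x (rfl | rfl | rfl)
  · apply subset_convexHull; simp
  · apply subset_convexHull; simp
  · exact h.mem_convexHull

lemma orient_eq_zero_of_mem_inter {t : Finset Plane} {p q r x : Plane} (hp : p ∉ t)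
    (hx : x ∈ convexHull ℝ ((({p, q, r} : Finset Plane) : Set Plane) ∩ t)) : orient q r x = 0 := by
  refine orient_eq_zero_of_mem_convexHull ?_ hx
  rintro y ⟨hy1, hy2⟩
  simp only [Finset.coe_insert, Finset.coe_singleton] at hy1
  rcases hy1 with rfl | rfl | rfl
  · exact absurd hy2 hp
  · simp
  · simp

/-- Edge-to-edge would put `m` in the hull of the common vertices, hence on a side line unless the
two triangles coincide. For labels, this shows that an inserted point has no earlier label to
conflict with. -/
lemma IsTriangulation.not_mem_of_strictlyInside {S : Set Plane} {T : Set (Finset Plane)}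
    (hT : IsTriangulation S T) {p q r m : Plane} (hs : {p, q, r} ∈ T)
    (hm : StrictlyInside p q r m) {t : Finset Plane} (ht : t ∈ T) : m ∉ t := by
  intro hmt
  have h1 : m ∈ convexHull ℝ ((({p, q, r} : Finset Plane) : Set Plane) ∩ t) := by
    refine convexHull_inter_subset_iff.1 (hT.edge_to_edge _ hs _ ht) m ?_ (subset_convexHull _ _ hmt)
    simpa using hm.mem_convexHull
  obtain ⟨hm1, hm2, hm3⟩ := hm
  by_cases hp : p ∈ t
  · by_cases hq : q ∈ t
    · by_cases hr : r ∈ t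
      · have : ({p, q, r} : Finset Plane) = t := by
          apply Finset.eq_of_subset_of_card_le
          · intro x; simp; rintro (rfl | rfl | rfl) <;> assumption
          · rw [hT.card_eq t ht, hT.card_eq _ hs]
        rw [← this] at hmt
        simp only [Finset.mem_insert, Finset.mem_singleton] at hmt
        rcases hmt with rfl | rfl | rfl <;> simp at *
      · rw [← triple_rotate, ← triple_rotate] at h1
        simp [orient_eq_zero_of_mem_inter hr h1] at hm1
    · rw [← triple_rotate] at h1
      simp [orient_eq_zero_of_mem_inter hq h1] at hm3
  · simp [orient_eq_zero_of_mem_inter hp h1] at hm2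

/-- The old triangle meets `pqr` in a common face. Unless that face avoids `r`, it lies on a side
through `r`, which the piece `pqm` touches at most in `p` or `q`. -/
lemma IsTriangulation.meet_of_strictlyInside {S : Set Plane} {T : Set (Finset Plane)}
    (hT : IsTriangulation S T) {p q r m : Plane} (hs : {p, q, r} ∈ T)
    (hm : StrictlyInside p q r m) {t : Finset Plane} (ht : t ∈ T) (hne : t ≠ {p, q, r}) {x : Plane}
    (hxt : x ∈ convexHull ℝ (t : Set Plane))
    (hx : x ∈ convexHull ℝ ((({p, q, m} : Finset Plane)) : Set Plane)) :
    x ∈ convexHull ℝ ((t : Set Plane) ∩ (({p, q, m} : Finset Plane) : Set Plane)) := by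
  have hx' : x ∈ convexHull ℝ ({p, q, m} : Set Plane) := by simpa using hx
  have h1 : x ∈ convexHull ℝ ((({p, q, r} : Finset Plane) : Set Plane) ∩ t) := by
    refine convexHull_inter_subset_iff.1 (hT.edge_to_edge _ hs _ ht) x ?_ hxt
    simpa using hm.convexHull_subset hx'
  obtain ⟨α, β, γ, hα, hβ, hγ, hsum, hxe⟩ := mem_convexHull_triple.1 hx'
  have hD := mul_self_pos.2 hm.orient_ne_zero
  have hD' := hm.orient_ne_zero
  obtain ⟨hm1, hm2, hm3⟩ := hm
  by_cases hr : r ∈ t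
  · by_cases hp : p ∈ t
    · have hq : q ∉ t := by
        intro hq
        apply hne
        symm
        apply Finset.eq_of_subset_of_card_le
        · intro x; simp; rintro (rfl | rfl | rfl) <;> assumption
        · rw [hT.card_eq t ht, hT.card_eq _ hs]
      rw [← triple_rotate] at h1
      have h0 := orient_eq_zero_of_mem_inter hq h1
      rw [hxe, orient_combo₃ _ _ _ _ _ hsum, orient_right, ← orient_rotate, ← orient_rotate] at h0
      replace h0 := congrArg (orient p q r * ·) h0
      simp only [orient_rotate] at h0 hm3
      have hγ0 : γ = 0 := by
        by_contra hne
        have : 0 < γ := lt_of_le_of_ne hγ (Ne.symm hne)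
        nlinarith [mul_nonneg hβ hD.le, mul_pos this hm3]
      have hβ0 : β = 0 := by
        subst hγ0
        simpa [hD'] using h0
      subst hγ0 hβ0
      obtain rfl : α = 1 := by linarith
      apply subset_convexHull
      simp only [one_smul, zero_smul, add_zero] at hxe
      subst hxe
      exact ⟨hp, by simp⟩
    · have h0 := orient_eq_zero_of_mem_inter hp h1
      rw [hxe, orient_combo₃ _ _ _ _ _ hsum, orient_left, orient_rotate] at h0
      replace h0 := congrArg (orient p q r * ·) h0
      have hγ0 : γ = 0 := by
        by_contra hne
        have : 0 < γ := lt_of_le_of_ne hγ (Ne.symm hne)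
        nlinarith [mul_nonneg hα hD.le, mul_pos this hm2]
      have hα0 : α = 0 := by
        subst hγ0
        simpa [hD'] using h0
      subst hγ0 hα0
      obtain rfl : β = 1 := by linarith
      simp only [one_smul, zero_smul, add_zero, zero_add] at hxe
      subst hxe
      have hq : x ∈ t := by
        by_contra hq
        rw [← triple_rotate] at h1
        have := orient_eq_zero_of_mem_inter hq h1
        rw [orient_rotate, orient_rotate] at this
        exact hD' this
      exact subset_convexHull _ _ ⟨hq, by simp⟩
  · apply convexHull_mono _ h1
    rintro y ⟨hy1, hy2⟩
    refine ⟨hy2, ?_⟩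
    simp only [Finset.coe_insert, Finset.coe_singleton] at hy1 ⊢
    rcases hy1 with rfl | rfl | rfl
    · simp
    · simp
    · exact absurd hy2 hr

lemma StrictlyInside.meet {p q r m x : Plane} (hm : StrictlyInside p q r m)
    (hx1 : x ∈ convexHull ℝ ((({p, q, m} : Finset Plane)) : Set Plane))
    (hx2 : x ∈ convexHull ℝ ((({q, r, m} : Finset Plane)) : Set Plane)) :
    x ∈ convexHull ℝ ((({p, q, m} : Finset Plane) : Set Plane) ∩
      (({q, r, m} : Finset Plane) : Set Plane)) := by
  simp only [Finset.coe_insert, Finset.coe_singleton] at hx1 hx2 ⊢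
  obtain ⟨α, β, γ, hα, hβ, hγ, hsum, hxe⟩ := mem_convexHull_triple.1 hx1
  obtain ⟨α', β', γ', hα', hβ', hγ', hsum', hxe'⟩ := mem_convexHull_triple.1 hx2
  have h0 : orient q m x = α * orient p q m := by
    rw [hxe, orient_combo₃ _ _ _ _ _ hsum]; simp [orient_rotate]
  have h1 : orient q m x = -(β' * orient q r m) := by
    rw [hxe', orient_combo₃ _ _ _ _ _ hsum', orient_swap' q r m]; simp
  obtain ⟨hm1, hm2, -⟩ := hm
  have hα0 : α = 0 := by
    by_contra hne
    have hpos : 0 < α := lt_of_le_of_ne hα (Ne.symm hne)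
    have h2 : α * (orient p q r * orient p q m) = -(β' * (orient p q r * orient q r m)) := by
      linear_combination orient p q r * (h1 - h0)
    nlinarith [mul_nonneg hβ' hm2.le, mul_pos hpos hm1]
  subst hα0
  rw [hxe, zero_smul, zero_add]
  refine convex_convexHull ℝ _ (subset_convexHull _ _ ?_) (subset_convexHull _ _ ?_) hβ hγ
    (by linarith) <;> simp

/-- The rays from `m` through the vertices cut the triangle into three sectors. If `x` were in none
of them, the three numbers `orient m · x` would share a sign, contradicting that their combination
with the positive barycentric weights of `m` vanishes. -/
lemma StrictlyInside.cover {p q r m x : Plane} (hm : StrictlyInside p q r m)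
    (hx : x ∈ convexHull ℝ ({p, q, r} : Set Plane)) :
    x ∈ convexHull ℝ ({p, q, m} : Set Plane) ∨ x ∈ convexHull ℝ ({q, r, m} : Set Plane) ∨
      x ∈ convexHull ℝ ({r, p, m} : Set Plane) := by
  rw [mem_convexHull_iff_orient hm.orient_ne_zero] at hx
  obtain ⟨hx1, hx2, hx3⟩ := hx
  obtain ⟨hm1, hm2, hm3⟩ := hm
  set D := orient p q r with hD
  have key : ∀ a b : Plane, 0 < D * orient a b m → 0 ≤ D * orient a b x →
      0 ≤ D * orient m a x → D * orient m b x ≤ 0 → x ∈ convexHull ℝ ({a, b, m} : Set Plane) := by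
    intro a b h1 h2 h3 h4
    have hne : orient a b m ≠ 0 := by rintro h; simp [h] at h1
    have hD2 : 0 < D * D := mul_self_pos.2 (by rintro h; simp [h] at h1)
    have aux : ∀ u : ℝ, 0 ≤ D * u → 0 ≤ orient a b m * u := by
      intro u hu
      have : 0 ≤ (D * D) * (orient a b m * u) := by
        have := mul_nonneg h1.le hu; nlinarith
      exact (mul_nonneg_iff_of_pos_left hD2).1 this
    rw [mem_convexHull_iff_orient hne]
    refine ⟨aux _ h2, aux _ ?_, aux _ h3⟩
    rw [orient_swap]; linarith
  have hsum : D * orient q r m * (D * orient m p x) + D * orient r p m * (D * orient m q x) +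
      D * orient p q m * (D * orient m r x) = 0 := by
    unfold orient; ring
  by_contra! hcon
  obtain ⟨c1, c2, c3⟩ := hcon
  have d1 := fun h3 h4 => c1 (key p q hm1 hx1 h3 h4)
  have d2 := fun h3 h4 => c2 (key q r hm2 hx2 h3 h4)
  have d3 := fun h3 h4 => c3 (key r p hm3 hx3 h3 h4)
  rcases le_or_gt 0 (D * orient m p x) with hp | hp
  · have hq : 0 < D * orient m q x := not_le.1 (d1 hp)
    have hr : 0 < D * orient m r x := not_le.1 (d2 hq.le)
    nlinarith [mul_nonneg hm2.le hp, mul_pos hm3 hq, mul_pos hm1 hr]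
  · have hr : D * orient m r x < 0 := not_le.1 fun h => d3 h hp.le
    have hq : D * orient m q x < 0 := not_le.1 fun h => d2 h hr.le
    nlinarith [mul_pos hm2 (neg_pos.2 hp), mul_pos hm3 (neg_pos.2 hq), mul_pos hm1 (neg_pos.2 hr)]

lemma StrictlyInside.orient_ne_zero' {p q r m : Plane} (h : StrictlyInside p q r m) :
    orient p q m ≠ 0 := by
  intro h0; have := h.1; simp [h0] at this

lemma card_triple_of_orient_ne_zero {p q r : Plane} (h : orient p q r ≠ 0) :
    ({p, q, r} : Finset Plane).card = 3 :=
  Finset.card_eq_three.2 ⟨p, q, r, (ne_of_orient_ne_zero h).1, (ne_of_orient_ne_zero h).2.1,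
    (ne_of_orient_ne_zero h).2.2, rfl⟩

/-- Subdividing a triangle of a triangulation by a point in its interior. -/
lemma IsTriangulation.subdivide {S : Set Plane} {T : Set (Finset Plane)}
    (hT : IsTriangulation S T) {p q r m : Plane} (hs : {p, q, r} ∈ T) (hmS : m ∈ S)
    (hm : StrictlyInside p q r m) :
    IsTriangulation S (T \ {{p, q, r}} ∪ {{p, q, m}, {q, r, m}, {r, p, m}}) := by
  have hs2 : ({q, r, p} : Finset Plane) ∈ T := by rwa [triple_rotate]
  have hs3 : ({r, p, q} : Finset Plane) ∈ T := by rwa [triple_rotate]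
  have hS := hT.vertices_subset _ hs
  simp only [Finset.coe_insert, Finset.coe_singleton, Set.insert_subset_iff,
    Set.singleton_subset_iff] at hS
  refine ⟨?_, ?_, ?_, ?_, ?_⟩
  · rintro t (⟨ht, -⟩ | rfl | rfl | rfl)
    · exact hT.vertices_subset t ht
    all_goals
      simp only [Finset.coe_insert, Finset.coe_singleton, Set.insert_subset_iff,
        Set.singleton_subset_iff]
      tauto
  · rintro t (⟨ht, -⟩ | rfl | rfl | rfl)
    · exact hT.card_eq t ht
    · exact card_triple_of_orient_ne_zero hm.orient_ne_zero'
    · exact card_triple_of_orient_ne_zero hm.rotate.orient_ne_zero'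
    · exact card_triple_of_orient_ne_zero hm.rotate.rotate.orient_ne_zero'
  · rintro t (⟨ht, -⟩ | rfl | rfl | rfl)
    · exact hT.affineIndependent t ht
    · exact affineIndependent_of_orient_ne_zero hm.orient_ne_zero'
    · exact affineIndependent_of_orient_ne_zero hm.rotate.orient_ne_zero'
    · exact affineIndependent_of_orient_ne_zero hm.rotate.rotate.orient_ne_zero'
  · rw [← hT.cover]
    have e2 := hm.rotate.convexHull_subset
    have e3 := hm.rotate.rotate.convexHull_subset
    rw [show ({q, r, p} : Set Plane) = {p, q, r} by ext; simp; tauto] at e2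
    rw [show ({r, p, q} : Set Plane) = {p, q, r} by ext; simp; tauto] at e3
    apply Set.Subset.antisymm
    · apply Set.iUnion₂_subset
      rintro t (⟨ht, -⟩ | rfl | rfl | rfl)
      · exact Set.subset_biUnion_of_mem (u := fun t : Finset Plane => convexHull ℝ (t : Set Plane)) ht
      all_goals
        refine Set.Subset.trans ?_ (Set.subset_biUnion_of_mem
          (u := fun t : Finset Plane => convexHull ℝ (t : Set Plane)) hs)
        simp only [Finset.coe_insert, Finset.coe_singleton]
      · exact hm.convexHull_subset
      · exact e2
      · exact e3
    · apply Set.iUnion₂_subset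
      intro t ht x hx
      simp only [Set.mem_iUnion]
      by_cases hts : t = {p, q, r}
      · subst hts
        simp only [Finset.coe_insert, Finset.coe_singleton] at hx
        rcases hm.cover hx with h | h | h
        · exact ⟨{p, q, m}, by simp, by simpa using h⟩
        · exact ⟨{q, r, m}, by simp, by simpa using h⟩
        · exact ⟨{r, p, m}, by simp, by simpa using h⟩
      · exact ⟨t, Or.inl ⟨ht, hts⟩, hx⟩
  · have old : ∀ s ∈ T \ {{p, q, r}}, ∀ t ∈ ({{p, q, m}, {q, r, m}, {r, p, m}} :
        Set (Finset Plane)), convexHull ℝ (s : Set Plane) ∩ convexHull ℝ (t : Set Plane) =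
          convexHull ℝ ((s : Set Plane) ∩ (t : Set Plane)) := by
      rintro s ⟨hsT, hne⟩ t ht
      rw [convexHull_inter_subset_iff]
      intro x hx1 hx2
      rcases ht with rfl | rfl | rfl
      · exact hT.meet_of_strictlyInside hs hm hsT hne hx1 hx2
      · exact hT.meet_of_strictlyInside hs2 hm.rotate hsT (by rwa [triple_rotate]) hx1 hx2
      · exact hT.meet_of_strictlyInside hs3 hm.rotate.rotate hsT
          (by rwa [triple_rotate, triple_rotate]) hx1 hx2
    rintro s (hs' | hs') t (ht' | ht')
    · exact hT.edge_to_edge s hs'.1 t ht'.1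
    · exact old s hs' t ht'
    · rw [Set.inter_comm, Set.inter_comm (s : Set Plane)]
      exact old t ht' s hs'
    · rw [convexHull_inter_subset_iff]
      intro x hx1 hx2
      rcases hs' with rfl | rfl | rfl <;> rcases ht' with rfl | rfl | rfl
      · rwa [Set.inter_self]
      · exact hm.meet hx1 hx2
      · rw [Set.inter_comm]; exact hm.rotate.rotate.meet hx2 hx1
      · rw [Set.inter_comm]; exact hm.meet hx2 hx1
      · rwa [Set.inter_self]
      · exact hm.rotate.meet hx1 hx2
      · exact hm.rotate.rotate.meet hx1 hx2
      · rw [Set.inter_comm]; exact hm.rotate.meet hx2 hx1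
      · rwa [Set.inter_self]

/-! ### Labeled triangles and their geometry -/

/-- The labeled black triangle `[ab][ac][bc]`. -/
def black (a b c : Plane) : Finset (Finset Plane) := {{a, b}, {a, c}, {b, c}}

/-- The labeled white triangle `[ya][yb][yc]`. -/
def white (y a b c : Plane) : Finset (Finset Plane) := {{y, a}, {y, b}, {y, c}}

lemma black_rotate (a b c : Plane) : black b c a = black a b c := by
  unfold black
  rw [Finset.pair_comm b a, Finset.pair_comm c a, triple_rotate, triple_rotate]

lemma white_rotate (y a b c : Plane) : white y b c a = white y a b c := triple_rotate _ _ _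

lemma avg_pair {a b : Plane} (h : a ≠ b) : avg {a, b} = (1 / 2 : ℝ) • (a + b) := by
  unfold avg
  rw [Finset.card_pair h, Finset.sum_pair h]; norm_num

lemma orient_avg_white {y a b c : Plane} (ha : y ≠ a) (hb : y ≠ b) (hc : y ≠ c) :
    orient (avg {y, a}) (avg {y, b}) (avg {y, c}) = orient a b c / 4 := by
  rw [avg_pair ha, avg_pair hb, avg_pair hc]
  simp only [orient, PiLp.add_apply, PiLp.smul_apply, smul_eq_mul]; ring

/-- The black triangle is the medial triangle, a copy of `aby` scaled by `-1/2`. The minus sign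
means that `[ab]` lies on the opposite side of the edge from the white apexes `[yz]` with `z` on the
side of `y`. -/
lemma orient_avg_black {y a b : Plane} (ha : y ≠ a) (hb : y ≠ b) (hab : a ≠ b) :
    orient (avg {y, a}) (avg {y, b}) (avg {a, b}) = -orient a b y / 4 := by
  rw [avg_pair ha, avg_pair hb, avg_pair hab]
  simp only [orient, PiLp.add_apply, PiLp.smul_apply, smul_eq_mul]; ring

lemma oppositeAngle_white {y a b c : Plane} (ha : y ≠ a) (hb : y ≠ b) (hc : y ≠ c) :
    oppositeAngle {y, a} {y, b} {y, c} = EuclideanGeometry.angle a c b := by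
  unfold oppositeAngle EuclideanGeometry.angle
  rw [avg_pair ha, avg_pair hb, avg_pair hc]
  have h1 : ∀ u v : Plane, (1 / 2 : ℝ) • (y + u) -ᵥ (1 / 2 : ℝ) • (y + v) =
      (1 / 2 : ℝ) • (u -ᵥ v) := by
    intro u v; rw [vsub_eq_sub, vsub_eq_sub]; module
  rw [h1, h1, InnerProductGeometry.angle_smul_left_of_pos _ _ (by norm_num),
    InnerProductGeometry.angle_smul_right_of_pos _ _ (by norm_num)]

lemma oppositeAngle_black {y a b : Plane} (ha : y ≠ a) (hb : y ≠ b) (hab : a ≠ b) :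
    oppositeAngle {y, a} {y, b} {a, b} = EuclideanGeometry.angle a y b := by
  unfold oppositeAngle EuclideanGeometry.angle
  rw [avg_pair ha, avg_pair hb, avg_pair hab]
  have h1 : (1 / 2 : ℝ) • (y + a) -ᵥ (1 / 2 : ℝ) • (a + b) = (1 / 2 : ℝ) • (-(b -ᵥ y)) := by
    rw [vsub_eq_sub, vsub_eq_sub]; module
  have h2 : (1 / 2 : ℝ) • (y + b) -ᵥ (1 / 2 : ℝ) • (a + b) = (1 / 2 : ℝ) • (-(a -ᵥ y)) := by
    rw [vsub_eq_sub, vsub_eq_sub]; module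
  rw [h1, h2, InnerProductGeometry.angle_smul_left_of_pos _ _ (by norm_num),
    InnerProductGeometry.angle_smul_right_of_pos _ _ (by norm_num),
    InnerProductGeometry.angle_neg_neg, InnerProductGeometry.angle_comm]

lemma pair_mem_kAverages {A : Finset Plane} {a b : Plane} (ha : a ∈ A) (hb : b ∈ A) (hab : a ≠ b) :
    avg {a, b} ∈ kAverages A 2 :=
  ⟨{a, b}, by simp [Finset.insert_subset_iff, ha, hb], Finset.card_pair hab, rfl⟩

lemma isWhite_of_ne {y a b c : Plane} (hab : a ≠ b) :
    IsWhite 2 {y, a} {y, b} {y, c} := by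
  unfold IsWhite
  have : ({y, a} ∩ {y, b} ∩ {y, c} : Finset Plane) = {y} := by
    ext x; simp only [Finset.mem_inter, Finset.mem_insert, Finset.mem_singleton]
    constructor
    · rintro ⟨⟨h | h, h' | h'⟩, -⟩
      · exact h
      · exact h
      · exact h'
      · exact absurd (h.symm.trans h') hab
    · tauto
  rw [this]; rfl

lemma isBlack_of_ne {y a b : Plane} (ha : y ≠ a) (hb : y ≠ b) (hab : a ≠ b) :
    IsBlack 2 {y, a} {y, b} {a, b} := by
  unfold IsBlack
  have : ({y, a} ∩ {y, b} ∩ {a, b} : Finset Plane) = ∅ := by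
    ext x
    simp only [Finset.mem_inter, Finset.mem_insert, Finset.mem_singleton, Finset.notMem_empty,
      iff_false]
    rintro ⟨⟨rfl | rfl, h | h⟩, h' | h'⟩ <;> simp_all
  rw [this]; rfl

/-! ### Every triangle is black or white -/

section Combinatorics

variable {A : Finset Plane} {P : Set (Finset (Finset Plane))}

lemma IsHypertriangulation.avg_injOn (hP : IsHypertriangulation A 2 P)
    {t : Finset (Finset Plane)} (ht : t ∈ P) : Set.InjOn avg (t : Set (Finset Plane)) :=
  fun I hI J hJ h => hP.label_unique t ht t ht I hI J hJ h

lemma IsHypertriangulation.card_eq (hP : IsHypertriangulation A 2 P)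
    {t : Finset (Finset Plane)} (ht : t ∈ P) : t.card = 3 := by
  rw [← hP.isTriangulation.card_eq _ ⟨t, ht, rfl⟩]
  exact (Finset.card_image_of_injOn (hP.avg_injOn ht)).symm

lemma IsHypertriangulation.finite (hP : IsHypertriangulation A 2 P) : P.Finite := by
  apply (Finset.finite_toSet A.powerset.powerset).subset
  intro t ht
  rw [Finset.mem_coe, Finset.mem_powerset]
  intro I hI
  exact Finset.mem_powerset.2 (hP.label_subset t ht I hI)

lemma IsHypertriangulation.ne_of_pair_mem (hP : IsHypertriangulation A 2 P)
    {t : Finset (Finset Plane)} (ht : t ∈ P) {a b : Plane} (h : {a, b} ∈ t) :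
    a ∈ A ∧ b ∈ A ∧ a ≠ b := by
  have h1 := hP.label_subset t ht _ h
  have h2 := hP.label_card t ht _ h
  refine ⟨h1 (by simp), h1 (by simp), ?_⟩
  rintro rfl
  simp at h2

lemma IsHypertriangulation.black_mem (hP : IsHypertriangulation A 2 P) {a b c : Plane}
    (h : black a b c ∈ P) : a ∈ A ∧ b ∈ A ∧ c ∈ A ∧ a ≠ b ∧ a ≠ c ∧ b ≠ c := by
  have h1 := hP.ne_of_pair_mem h (a := a) (b := b) (by simp [black])
  have h2 := hP.ne_of_pair_mem h (a := a) (b := c) (by simp [black])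
  have h3 := hP.ne_of_pair_mem h (a := b) (b := c) (by simp [black])
  tauto

lemma IsHypertriangulation.white_mem (hP : IsHypertriangulation A 2 P) {y a b c : Plane}
    (h : white y a b c ∈ P) : y ∈ A ∧ a ∈ A ∧ b ∈ A ∧ c ∈ A ∧ y ≠ a ∧ y ≠ b ∧ y ≠ c ∧
      a ≠ b ∧ a ≠ c ∧ b ≠ c := by
  have h1 := hP.ne_of_pair_mem h (a := y) (b := a) (by simp [white])
  have h2 := hP.ne_of_pair_mem h (a := y) (b := b) (by simp [white])
  have h3 := hP.ne_of_pair_mem h (a := y) (b := c) (by simp [white])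
  have hc := hP.card_eq h
  refine ⟨h1.1, h1.2.1, h2.2.1, h3.2.1, h1.2.2, h2.2.2, h3.2.2, ?_, ?_, ?_⟩ <;> rintro rfl
  · have : white y a a c = {{y, a}, {y, c}} := by simp [white]
    rw [this] at hc
    have := Finset.card_le_two (a := ({y, a} : Finset Plane)) (b := {y, c})
    omega
  · have : white y a b a = {{y, a}, {y, b}} := by ext; simp [white]; tauto
    rw [this] at hc
    have := Finset.card_le_two (a := ({y, a} : Finset Plane)) (b := {y, b})
    omega
  · have : white y a b b = {{y, a}, {y, b}} := by ext; simp [white]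
    rw [this] at hc
    have := Finset.card_le_two (a := ({y, a} : Finset Plane)) (b := {y, b})
    omega

lemma exists_eq_triple {α : Type*} [DecidableEq α] {t : Finset α} (ht : t.card = 3) {p q : α}
    (hp : p ∈ t) (hq : q ∈ t) (hpq : p ≠ q) : ∃ l, l ≠ p ∧ l ≠ q ∧ t = {p, q, l} := by
  have hq' : q ∈ t.erase p := Finset.mem_erase.2 ⟨hpq.symm, hq⟩
  obtain ⟨l, hl⟩ : ∃ l, (t.erase p).erase q = {l} := by
    rw [← Finset.card_eq_one, Finset.card_erase_of_mem hq', Finset.card_erase_of_mem hp, ht]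
  have hl' : l ∈ (t.erase p).erase q := by simp [hl]
  simp only [Finset.mem_erase] at hl'
  exact ⟨l, hl'.2.1, hl'.1, by rw [← hl, Finset.insert_erase hq', Finset.insert_erase hp]⟩

lemma exists_eq_pair {I : Finset Plane} (hI : I.card = 2) {y : Plane} (hy : y ∈ I) :
    ∃ a, y ≠ a ∧ I = {y, a} := by
  obtain ⟨a, ha⟩ : ∃ a, I.erase y = {a} := by
    rw [← Finset.card_eq_one, Finset.card_erase_of_mem hy, hI]
  have ha' : a ∈ I.erase y := by simp [ha]
  exact ⟨a, (Finset.mem_erase.1 ha').1.symm, by rw [← ha, Finset.insert_erase hy]⟩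

/-- If the third label contains `y`, the triangle is white. Otherwise it must meet both `{y, a}` and
`{y, b}` away from `y`, which forces it to be `{a, b}`. -/
lemma IsHypertriangulation.classify (hP : IsHypertriangulation A 2 P)
    {t : Finset (Finset Plane)} (ht : t ∈ P) {y a b : Plane} (ha : {y, a} ∈ t) (hb : {y, b} ∈ t)
    (hab : a ≠ b) : t = black y a b ∨ ∃ c, t = white y a b c := by
  obtain ⟨-, -, hya⟩ := hP.ne_of_pair_mem ht ha
  obtain ⟨-, -, hyb⟩ := hP.ne_of_pair_mem ht hb
  have hne : ({y, a} : Finset Plane) ≠ {y, b} := by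
    intro h
    have : a ∈ ({y, b} : Finset Plane) := by rw [← h]; simp
    simp only [Finset.mem_insert, Finset.mem_singleton] at this
    tauto
  obtain ⟨K, hKa, hKb, rfl⟩ := exists_eq_triple (hP.card_eq ht) ha hb hne
  have hK2 := hP.label_card _ ht K (by simp)
  by_cases hy : y ∈ K
  · obtain ⟨c, -, rfl⟩ := exists_eq_pair hK2 hy
    exact Or.inr ⟨c, rfl⟩
  · left
    have aux : ∀ u, {y, u} ∈ ({{y, a}, {y, b}, K} : Finset (Finset Plane)) → K ≠ {y, u} →
        u ∈ K := by
      intro u hu hKu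
      have h1 := hP.edge _ ht _ hu K (by simp) hKu.symm
      have h2 : ({y, u} ∩ K : Finset Plane).Nonempty := by
        rw [← Finset.card_pos]; omega
      obtain ⟨x, hx⟩ := h2
      simp only [Finset.mem_inter, Finset.mem_insert, Finset.mem_singleton] at hx
      obtain ⟨rfl | rfl, hx⟩ := hx
      · exact absurd hx hy
      · exact hx
    have haK := aux a ha hKa
    have hbK := aux b hb hKb
    have : ({a, b} : Finset Plane) = K := by
      apply Finset.eq_of_subset_of_card_le
      · simp [Finset.insert_subset_iff, haK, hbK]
      · rw [hK2, Finset.card_pair hab]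
    rw [← this]; rfl

lemma IsHypertriangulation.exists_edge (hP : IsHypertriangulation A 2 P)
    {t : Finset (Finset Plane)} (ht : t ∈ P) {I J : Finset Plane} (hI : I ∈ t) (hJ : J ∈ t)
    (hIJ : I ≠ J) : ∃ y a b, I = {y, a} ∧ J = {y, b} ∧ a ≠ b := by
  have h1 := hP.edge t ht I hI J hJ hIJ
  have h2 : (I ∩ J).Nonempty := by rw [← Finset.card_pos]; omega
  obtain ⟨y, hy⟩ := h2
  rw [Finset.mem_inter] at hy
  obtain ⟨a, -, rfl⟩ := exists_eq_pair (hP.label_card t ht I hI) hy.1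
  obtain ⟨b, -, rfl⟩ := exists_eq_pair (hP.label_card t ht J hJ) hy.2
  exact ⟨y, a, b, rfl, rfl, fun h => hIJ (by rw [h])⟩

/-- Every triangle of a level-2 hypertriangulation is black or white. -/
lemma IsHypertriangulation.black_or_white (hP : IsHypertriangulation A 2 P)
    {t : Finset (Finset Plane)} (ht : t ∈ P) :
    (∃ a b c, t = black a b c) ∨ ∃ y a b c, t = white y a b c := by
  obtain ⟨I, J, K, hIJ, hIK, hJK, rfl⟩ := Finset.card_eq_three.1 (hP.card_eq ht)
  obtain ⟨y, a, b, hI, hJ, hab⟩ := hP.exists_edge ht (I := I) (J := J) (by simp) (by simp) hIJ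
  rcases hP.classify ht (y := y) (a := a) (b := b) (by simp [hI]) (by simp [hJ]) hab with h | ⟨c, h⟩
  · exact Or.inl ⟨y, a, b, h⟩
  · exact Or.inr ⟨y, a, b, c, h⟩

end Combinatorics

/-! ### From the local angle property to global emptiness of circles -/

section Local

variable {A : Finset Plane} {P : Set (Finset (Finset Plane))}

/-- The geometric neighbor carries the same labels on the shared edge by uniqueness of labels, so
its third label is of white or black type; the sign says on which side of `ab` the apex or `y` lies.
-/
lemma IsHypertriangulation.exists_neighbor (hP : IsHypertriangulation A 2 P) {y a b : Plane}
    {K : Finset Plane} (hs : {{y, a}, {y, b}, K} ∈ P) (hab : a ≠ b) {m : Plane}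
    (hm : m ∈ kAverages A 2)
    (hneg : orient (avg {y, a}) (avg {y, b}) m * orient (avg {y, a}) (avg {y, b}) (avg K) < 0) :
    (∃ z, white y a b z ∈ P ∧ orient a b z * orient (avg {y, a}) (avg {y, b}) (avg K) < 0) ∨
      (black y a b ∈ P ∧ 0 < orient a b y * orient (avg {y, a}) (avg {y, b}) (avg K)) := by
  set D := orient (avg {y, a}) (avg {y, b}) (avg K) with hD
  have hs' : ({avg {y, a}, avg {y, b}, avg K} : Finset Plane) ∈ geometric P :=
    ⟨_, hs, by simp [Finset.image_insert]⟩
  obtain ⟨l, ⟨t, ht, htl⟩, hl⟩ := hP.isTriangulation.exists_neighbor (hP.finite.image _) hs'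
    (subset_convexHull _ _ hm) hneg
  rw [← hD] at hl
  replace htl : t.image avg = {avg {y, a}, avg {y, b}, l} := htl
  have hmem : ∀ I ∈ ({{y, a}, {y, b}, K} : Finset (Finset Plane)), avg I ∈ t.image avg → I ∈ t := by
    intro I hI h
    obtain ⟨J, hJ, hJI⟩ := Finset.mem_image.1 h
    rwa [← hP.label_unique t ht _ hs J hJ I hI hJI]
  have ha : {y, a} ∈ t := hmem _ (by simp) (by rw [htl]; simp)
  have hb : {y, b} ∈ t := hmem _ (by simp) (by rw [htl]; simp)
  have third : ∀ M : Finset Plane, t = {{y, a}, {y, b}, M} → l = avg M := by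
    intro M hM
    have h1 : l ∈ t.image avg := by rw [htl]; simp
    rw [hM] at h1
    simp only [Finset.mem_image, Finset.mem_insert, Finset.mem_singleton] at h1
    obtain ⟨J, rfl | rfl | rfl, rfl⟩ := h1
    · simp at hl
    · simp at hl
    · rfl
  rcases hP.classify ht ha hb hab with rfl | ⟨z, rfl⟩
  · right
    obtain ⟨-, -, -, hya, hyb, -⟩ := hP.black_mem ht
    refine ⟨ht, ?_⟩
    rw [third _ rfl, orient_avg_black hya hyb hab] at hl
    linarith
  · left
    obtain ⟨-, -, -, -, hya, hyb, hyz, -⟩ := hP.white_mem ht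
    refine ⟨z, ht, ?_⟩
    rw [third _ rfl, orient_avg_white hya hyb hyz] at hl
    linarith

lemma IsHypertriangulation.exists_neighbor_white (hP : IsHypertriangulation A 2 P)
    {y a b c d : Plane} (hs : white y a b c ∈ P) (hd : d ∈ A) (hyd : y ≠ d)
    (hneg : orient a b d * orient a b c < 0) :
    (∃ z, white y a b z ∈ P ∧ orient a b z * orient a b c < 0) ∨
      (black y a b ∈ P ∧ 0 < orient a b y * orient a b c) := by
  obtain ⟨hy, ha, hb, hc, hya, hyb, hyc, hab, hac, hbc⟩ := hP.white_mem hs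
  have h := hP.exists_neighbor hs hab (pair_mem_kAverages hy hd hyd) (by
    rw [orient_avg_white hya hyb hyd, orient_avg_white hya hyb hyc]; linarith)
  rw [orient_avg_white hya hyb hyc] at h
  rcases h with ⟨z, hz, h⟩ | ⟨hz, h⟩
  · exact Or.inl ⟨z, hz, by linarith⟩
  · exact Or.inr ⟨hz, by linarith⟩

/-- The witness that the edge is not on the boundary is `[ab]`, which lies beyond `[ya][yb]` when
`y` and `c` are on the same side of `ab`. -/
lemma IsHypertriangulation.exists_neighbor_white' (hP : IsHypertriangulation A 2 P)
    {y a b c : Plane} (hs : white y a b c ∈ P) (hpos : 0 < orient a b y * orient a b c) :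
    (∃ z, white y a b z ∈ P ∧ orient a b z * orient a b c < 0) ∨ black y a b ∈ P := by
  obtain ⟨hy, ha, hb, hc, hya, hyb, hyc, hab, hac, hbc⟩ := hP.white_mem hs
  have h := hP.exists_neighbor hs hab (pair_mem_kAverages ha hb hab) (by
    rw [orient_avg_black hya hyb hab, orient_avg_white hya hyb hyc]; linarith)
  rw [orient_avg_white hya hyb hyc] at h
  rcases h with ⟨z, hz, h⟩ | ⟨hz, h⟩
  · exact Or.inl ⟨z, hz, by linarith⟩
  · exact Or.inr hz

lemma IsHypertriangulation.exists_neighbor_black (hP : IsHypertriangulation A 2 P)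
    {y a b d : Plane} (hs : black y a b ∈ P) (hd : d ∈ A) (hyd : y ≠ d)
    (hpos : 0 < orient a b y * orient a b d) :
    ∃ z, white y a b z ∈ P ∧ 0 < orient a b z * orient a b y := by
  obtain ⟨hy, ha, hb, hya, hyb, hab⟩ := hP.black_mem hs
  have h := hP.exists_neighbor hs hab (pair_mem_kAverages hy hd hyd) (by
    rw [orient_avg_white hya hyb hyd, orient_avg_black hya hyb hab]; linarith)
  rw [orient_avg_black hya hyb hab] at h
  rcases h with ⟨z, hz, h⟩ | ⟨hz, h⟩
  · exact ⟨z, hz, by linarith⟩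
  -- A black neighbor across this edge would be the original triangle, which is on the wrong side.
  · nlinarith [mul_self_nonneg (orient a b y)]

/-- For apexes on opposite sides of `ab`, angle sum at most `π` means that `d` is not inside the
circle `abc`; genericity rules out equality. -/
lemma HasLocalAngleProperty.pw_pos_of_white (hL : HasLocalAngleProperty 2 P)
    (hA : IsGeneric A) (hP : IsHypertriangulation A 2 P) {y a b c d : Plane}
    (hc : white y a b c ∈ P) (hd : white y a b d ∈ P) (hneg : orient a b d * orient a b c < 0) :
    0 < pw a b c d := by
  obtain ⟨hyA, haA, hbA, hcA, hya, hyb, hyc, hab, hac, hbc⟩ := hP.white_mem hc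
  obtain ⟨-, -, -, hdA, -, -, hyd, -, had, hbd⟩ := hP.white_mem hd
  have hcd : c ≠ d := by rintro rfl; nlinarith [mul_self_nonneg (orient a b c)]
  have hoc : orient a b c ≠ 0 := by rintro h; simp [h] at hneg
  have hod : orient a b d ≠ 0 := by rintro h; simp [h] at hneg
  have hne : ({y, c} : Finset Plane) ≠ {y, d} := by
    intro h
    have : c ∈ ({y, d} : Finset Plane) := by rw [← h]; simp
    simp only [Finset.mem_insert, Finset.mem_singleton] at this
    tauto
  have h1 := hL.ww _ _ _ _ hc hd hne (isWhite_of_ne hab) (isWhite_of_ne hab)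
  rw [oppositeAngle_white hya hyb hyc, oppositeAngle_white hya hyb hyd,
    angle_add_le_pi_iff hoc hod] at h1
  refine lt_of_le_of_ne ?_ (hA.pw_ne_zero haA hbA hcA hdA hab hac had hbc hbd hcd).symm
  have h2 := pw_mul hoc d
  rcases lt_or_gt_of_ne hoc with h | h
  · have h3 : 0 < orient a b d := by nlinarith
    rw [abs_of_neg h, abs_of_pos h3] at h1
    nlinarith
  · have h3 : orient a b d < 0 := by nlinarith
    rw [abs_of_pos h, abs_of_neg h3] at h1
    nlinarith

/-- For apexes on the same side of `ab`, the larger angle belongs to the apex inside the other's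
circle. -/
lemma HasLocalAngleProperty.pw_of_black_white (hL : HasLocalAngleProperty 2 P)
    (hP : IsHypertriangulation A 2 P) {y a b z : Plane}
    (hb : black y a b ∈ P) (hw : white y a b z ∈ P) (hpos : 0 < orient a b z * orient a b y) :
    0 < pw a b y z ∧ pw a b z y < 0 := by
  obtain ⟨hyA, haA, hbA, hzA, hya, hyb, hyz, hab, haz, hbz⟩ := hP.white_mem hw
  have hoz : orient a b z ≠ 0 := by rintro h; simp [h] at hpos
  have hoy : orient a b y ≠ 0 := by rintro h; simp [h] at hpos
  have h1 := hL.bw _ _ _ _ hb hw (isBlack_of_ne hya hyb hab) (isWhite_of_ne hab)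
  rw [oppositeAngle_white hya hyb hyz, oppositeAngle_black hya hyb hab,
    angle_lt_angle_iff hoy hoz] at h1
  have h2 := pw_mul hoy z
  have h3 := pw_mul hoz y
  rcases lt_or_gt_of_ne hoy with h | h
  · have h4 : orient a b z < 0 := by nlinarith
    rw [abs_of_neg h, abs_of_neg h4] at h1
    constructor <;> nlinarith
  · have h4 : 0 < orient a b z := by nlinarith
    rw [abs_of_pos h, abs_of_pos h4] at h1
    constructor <;> nlinarith

/-- If `z` lies outside the circle `abc`, then passing to the circle `abz` decreases the power of
the points beyond `ab` on the side of `z`. -/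
lemma pw_lt_of_pos {a b c z d : Plane} (hpos : 0 < orient a b z * orient a b d)
    (h : 0 < pw a b c z) : pw a b z d < pw a b c d := by
  have hz : orient a b z ≠ 0 := by rintro h; simp [h] at hpos
  rw [pw_eq_mul hz] at h
  rw [← sub_pos, pw_sub]
  have h1 := mul_pos hpos h
  have h2 : 0 < orient a b z ^ 2 := by positivity
  refine (mul_pos_iff_of_pos_left h2).1 ?_
  linarith

/-- If `z` lies inside the circle `abc`, then passing to the circle `abz` decreases the power of
the points on the other side of `ab`. -/
lemma pw_lt_of_neg {a b c z d : Plane} (hneg : orient a b z * orient a b d < 0)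
    (h : pw a b c z < 0) : pw a b z d < pw a b c d := by
  have hz : orient a b z ≠ 0 := by rintro h; simp [h] at hneg
  rw [pw_eq_mul hz] at h
  rw [← sub_pos, pw_sub]
  have h1 := mul_pos_of_neg_of_neg hneg h
  have h2 : 0 < orient a b z ^ 2 := by positivity
  refine (mul_pos_iff_of_pos_left h2).1 ?_
  linarith

lemma mul_pos_of_mul_neg {x y z : ℝ} (h1 : x * y < 0) (h2 : z * y < 0) : 0 < x * z := by
  have h3 := mul_pos_of_neg_of_neg h1 h2
  have hy : y ≠ 0 := by rintro rfl; simp at h1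
  have : 0 < y ^ 2 := by positivity
  refine (mul_pos_iff_of_pos_left this).1 ?_
  linarith

lemma mul_neg_of_mul_pos {x y z : ℝ} (h1 : 0 < x * y) (h2 : z * y < 0) : x * z < 0 := by
  have h3 := mul_neg_of_pos_of_neg h1 h2
  have hy : y ≠ 0 := by rintro rfl; simp at h2
  have : 0 < y ^ 2 := by positivity
  have h4 : 0 < y ^ 2 * -(x * z) := by linarith
  linarith [(mul_pos_iff_of_pos_left this).1 h4]

lemma mul_pos_of_mul_pos {x y z : ℝ} (h1 : 0 < x * y) (h2 : 0 < y * z) : 0 < x * z := by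
  have h3 := mul_pos h1 h2
  have hy : y ≠ 0 := by rintro rfl; simp at h1
  have : 0 < y ^ 2 := by positivity
  refine (mul_pos_iff_of_pos_left this).1 ?_
  linarith

lemma HasLocalAngleProperty.step_black (hL : HasLocalAngleProperty 2 P)
    (hP : IsHypertriangulation A 2 P) {y a b d : Plane}
    (hs : black y a b ∈ P) (hd : d ∈ A) (hyd : y ≠ d)
    (hpos : 0 < orient a b y * orient a b d) :
    ∃ z, white y a b z ∈ P ∧ pw a b z d < pw a b y d := by
  obtain ⟨z, hz, hzy⟩ := hP.exists_neighbor_black hs hd hyd hpos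
  exact ⟨z, hz, pw_lt_of_pos (mul_pos_of_mul_pos hzy hpos)
    (hL.pw_of_black_white hP hs hz hzy).1⟩

lemma HasLocalAngleProperty.step_white (hL : HasLocalAngleProperty 2 P)
    (hA : IsGeneric A) (hP : IsHypertriangulation A 2 P) {y a b c d : Plane}
    (hs : white y a b c ∈ P) (hd : d ∈ A) (hyd : y ≠ d)
    (hneg : orient a b d * orient a b c < 0) :
    (∃ z, white y a b z ∈ P ∧ pw a b z d < pw a b c d) ∨
      (black y a b ∈ P ∧ pw a b y d < pw a b c d) := by
  rcases hP.exists_neighbor_white hs hd hyd hneg with ⟨z, hz, hzc⟩ | ⟨hb, hyc⟩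
  · exact Or.inl ⟨z, hz, pw_lt_of_pos (mul_pos_of_mul_neg hzc hneg)
      (hL.pw_pos_of_white hA hP hs hz hzc)⟩
  · refine Or.inr ⟨hb, pw_lt_of_neg (mul_neg_of_mul_pos hyc hneg)
      (hL.pw_of_black_white hP hb hs (by linarith)).2⟩

/-- A white neighbor has its apex outside the circle `abc` and beyond `ab`, so passing to its circle
raises the power on the side of `y`. A black neighbor gives the negative sign at once. -/
lemma HasLocalAngleProperty.step_center (hL : HasLocalAngleProperty 2 P)
    (hA : IsGeneric A) (hP : IsHypertriangulation A 2 P) {y a b c : Plane}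
    (hs : white y a b c ∈ P) (hpos : 0 < orient a b y * orient a b c) :
    pw a b c y < 0 ∨ ∃ z, white y a b z ∈ P ∧ pw a b c y < pw a b z y := by
  rcases hP.exists_neighbor_white' hs hpos with ⟨z, hz, hzc⟩ | hb
  · right
    refine ⟨z, hz, ?_⟩
    have h1 := hL.pw_pos_of_white hA hP hs hz hzc
    have hoz : orient a b z ≠ 0 := by rintro h; simp [h] at hzc
    rw [pw_eq_mul hoz] at h1
    rw [← sub_neg, pw_sub]
    have h2 : orient a b y * orient a b z < 0 := mul_neg_of_mul_pos hpos hzc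
    have h3 := mul_neg_of_neg_of_pos h2 h1
    have h4 : 0 < orient a b z ^ 2 := by positivity
    refine neg_pos.1 ((mul_pos_iff_of_pos_left h4).1 ?_)
    linarith
  · exact Or.inl (hL.pw_of_black_white hP hb hs (by linarith)).2

lemma pw_rotate {a b c : Plane} (h : orient a b c ≠ 0) (x : Plane) : pw b c a x = pw a b c x := by
  rw [pw_swap' (by rwa [orient_swap, neg_ne_zero]), pw_swap]

@[simp] lemma pw_left (a b c : Plane) : pw a b c a = 0 := by simp [pw, dotAt]

@[simp] lemma pw_mid (a b c : Plane) : pw a b c b = 0 := by simp [pw, dotAt]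

lemma pw_last {a b c : Plane} (h : orient a b c ≠ 0) : pw a b c c = 0 := by
  unfold pw; field_simp; ring

/-- The white triangles are empty. -/
def WhiteEmpty (A : Finset Plane) (P : Set (Finset (Finset Plane))) : Prop :=
  ∀ y a b c d, white y a b c ∈ P → d ∈ A → y ≠ d → ¬ StrictlyInside a b c d

/-- Descent: a triangle minimizing a negative power of `d` would have a neighbor of the admitted
kinds with smaller power. The condition `y ≠ d` survives every crossing: from white to white `y`
stays the same, and from black to white the new common point is a vertex of the black triangle,
which has power zero. -/
lemma HasLocalAngleProperty.pw_nonneg (hL : HasLocalAngleProperty 2 P)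
    (hA : IsGeneric A) (hP : IsHypertriangulation A 2 P) (hE : WhiteEmpty A P) {a b c d : Plane}
    (hd : d ∈ A) (h : black a b c ∈ P ∨ ∃ y, white y a b c ∈ P ∧ y ≠ d) : 0 ≤ pw a b c d := by
  set R : Plane × Plane × Plane → Prop := fun q =>
    black q.1 q.2.1 q.2.2 ∈ P ∨ ∃ y, white y q.1 q.2.1 q.2.2 ∈ P ∧ y ≠ d with hR
  have hRA : ∀ a b c, R (a, b, c) → (a ∈ A ∧ b ∈ A ∧ c ∈ A) ∧ a ≠ b ∧ a ≠ c ∧ b ≠ c := by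
    rintro a b c (h | ⟨y, h, -⟩)
    · have := hP.black_mem h; tauto
    · have := hP.white_mem h; tauto
  set F := (A ×ˢ A ×ˢ A).filter R with hF
  have hmemF : ∀ a b c, R (a, b, c) → (a, b, c) ∈ F := by
    intro a b c h
    simp only [hF, Finset.mem_filter, Finset.mem_product]
    exact ⟨(hRA a b c h).1, h⟩
  obtain ⟨⟨a₀, b₀, c₀⟩, hq, hmin⟩ := F.exists_min_image (fun q => pw q.1 q.2.1 q.2.2 d)
    ⟨_, hmemF a b c h⟩
  have hmin' : ∀ a b c, R (a, b, c) → pw a₀ b₀ c₀ d ≤ pw a b c d :=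
    fun a b c h => hmin _ (hmemF a b c h)
  have hR0 : R (a₀, b₀, c₀) := (Finset.mem_filter.1 hq).2
  refine le_trans ?_ (hmin' a b c h)
  clear! a b c
  rename' a₀ => a, b₀ => b, c₀ => c
  obtain ⟨⟨ha, hb, hc⟩, hab, hac, hbc⟩ := hRA a b c hR0
  have ho := hA.orient_ne_zero ha hb hc hab hac hbc
  by_contra! hlt
  have had : a ≠ d := by rintro rfl; simp at hlt
  have hbd : b ≠ d := by rintro rfl; simp at hlt
  have hcd : c ≠ d := by rintro rfl; simp [pw_last ho] at hlt
  rcases hR0 with hbl | ⟨y, hw, hyd⟩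
  · have step : ∀ a b c, black a b c ∈ P → a ≠ d → 0 < orient b c a * orient b c d →
        ∃ z, R (b, c, z) ∧ pw b c z d < pw b c a d := by
      intro a b c h1 h2 h3
      obtain ⟨z, hz, hlt⟩ := hL.step_black hP h1 hd h2 h3
      exact ⟨z, Or.inr ⟨a, hz, h2⟩, hlt⟩
    have hbl2 : black b c a ∈ P := by rwa [black_rotate]
    have hbl3 : black c a b ∈ P := by rwa [← black_rotate]
    have hpw2 : pw b c a d = pw a b c d := pw_rotate ho d
    have hpw3 : pw c a b d = pw a b c d := by
      rw [← pw_rotate ho, pw_rotate]; rwa [orient_rotate]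
    have hno : ∀ x, x ≠ 0 → 0 < x ∨ x < 0 := fun x hx => (lt_or_gt_of_ne hx).symm
    have hsum := orient_sum a b c d
    have n1 : ¬ 0 < orient a b c * orient b c d := fun h => by
      obtain ⟨z, hz, hz'⟩ := step a b c hbl had (by rwa [orient_rotate])
      linarith [hmin' _ _ _ hz]
    have n2 : ¬ 0 < orient a b c * orient c a d := fun h => by
      obtain ⟨z, hz, hz'⟩ := step b c a hbl2 hbd (by rwa [orient_rotate b c a, orient_rotate])
      linarith [hmin' _ _ _ hz]
    have n3 : ¬ 0 < orient a b c * orient a b d := fun h => by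
      obtain ⟨z, hz, hz'⟩ := step c a b hbl3 hcd h
      linarith [hmin' _ _ _ hz]
    -- The three signed areas sum to that of `abc`, so `d` is on the inner side of at least one edge
    -- line, and that edge can be crossed.
    have := mul_self_pos.2 ho
    rw [← hsum] at this n1 n2 n3
    nlinarith
  · have step : ∀ a b c, white y a b c ∈ P → orient a b d * orient a b c < 0 →
        ∃ z, R (a, b, z) ∧ pw a b z d < pw a b c d := by
      intro a b c h1 h3
      rcases hL.step_white hA hP h1 hd hyd h3 with ⟨z, hz, hlt⟩ | ⟨hz, hlt⟩
      · exact ⟨z, Or.inr ⟨y, hz, hyd⟩, hlt⟩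
      · exact ⟨y, Or.inl (by rwa [black_rotate]), hlt⟩
    have hw2 : white y b c a ∈ P := by rwa [white_rotate]
    have hw3 : white y c a b ∈ P := by rwa [← white_rotate]
    have hpw2 : pw b c a d = pw a b c d := pw_rotate ho d
    have hpw3 : pw c a b d = pw a b c d := by
      rw [← pw_rotate ho, pw_rotate]; rwa [orient_rotate]
    have aux : ∀ x y : ℝ, x ≠ 0 → y ≠ 0 → ¬ y * x < 0 → 0 < x * y := by
      intro x y hx hy h
      rw [mul_comm]
      exact lt_of_le_of_ne (not_lt.1 h) (mul_ne_zero hy hx).symm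
    -- If no edge of the white triangle can be crossed towards `d`, then `d` is strictly inside
    -- `abc`; genericity excludes the edge lines.
    refine hE y a b c d hw hd hyd ⟨aux _ _ ho (hA.orient_ne_zero ha hb hd hab had hbd) fun h => ?_,
      aux _ _ ho (hA.orient_ne_zero hb hc hd hbc hbd hcd) fun h => ?_,
      aux _ _ ho (hA.orient_ne_zero hc ha hd hac.symm hcd had) fun h => ?_⟩
    · obtain ⟨z, hz, hz'⟩ := step a b c hw h
      linarith [hmin' _ _ _ hz]
    · obtain ⟨z, hz, hz'⟩ := step b c a hw2 (by rwa [orient_rotate a b c])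
      linarith [hmin' _ _ _ hz]
    · obtain ⟨z, hz, hz'⟩ := step c a b hw3 (by rwa [orient_rotate b c a, orient_rotate a b c])
      linarith [hmin' _ _ _ hz]

/-- Take the largest power of `y` among the white triangles with common point `y`. Some side of
`abc` has `y` on its inner side, and there `step_center` gives either a larger power, which is
impossible, or a negative one. -/
lemma HasLocalAngleProperty.pw_center_neg (hL : HasLocalAngleProperty 2 P)
    (hA : IsGeneric A) (hP : IsHypertriangulation A 2 P) {y a b c : Plane}
    (h : white y a b c ∈ P) : pw a b c y < 0 := by
  have hmem : ∀ a b c, white y a b c ∈ P → (a, b, c) ∈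
      (A ×ˢ A ×ˢ A).filter fun q => white y q.1 q.2.1 q.2.2 ∈ P := by
    intro a b c h
    simp only [Finset.mem_filter, Finset.mem_product]
    have := hP.white_mem h
    tauto
  obtain ⟨⟨a₀, b₀, c₀⟩, hq, hmax⟩ := Finset.exists_max_image _
    (fun q => pw q.1 q.2.1 q.2.2 y) ⟨_, hmem a b c h⟩
  have hmax' : ∀ a b c, white y a b c ∈ P → pw a b c y ≤ pw a₀ b₀ c₀ y :=
    fun a b c h => hmax _ (hmem a b c h)
  have hw : white y a₀ b₀ c₀ ∈ P := (Finset.mem_filter.1 hq).2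
  refine lt_of_le_of_lt (hmax' a b c h) ?_
  clear! a b c
  rename' a₀ => a, b₀ => b, c₀ => c
  obtain ⟨hy, ha, hb, hc, hya, hyb, hyc, hab, hac, hbc⟩ := hP.white_mem hw
  have ho := hA.orient_ne_zero ha hb hc hab hac hbc
  have hw2 : white y b c a ∈ P := by rwa [white_rotate]
  have hw3 : white y c a b ∈ P := by rwa [← white_rotate]
  have hpw2 : pw b c a y = pw a b c y := pw_rotate ho y
  have hpw3 : pw c a b y = pw a b c y := by
    rw [← pw_rotate ho, pw_rotate]; rwa [orient_rotate]
  by_contra hlt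
  have step : ∀ a' b' c', white y a' b' c' ∈ P → pw a' b' c' y = pw a b c y →
      ¬ 0 < orient a' b' y * orient a' b' c' := by
    intro a' b' c' h1 h2 h3
    rcases hL.step_center hA hP h1 h3 with h4 | ⟨z, hz, h4⟩
    · exact hlt (h2 ▸ h4)
    · linarith [hmax' _ _ _ hz]
  have n1 := step a b c hw rfl
  have n2 := step b c a hw2 hpw2
  have n3 := step c a b hw3 hpw3
  rw [orient_rotate a b c] at n2
  rw [orient_rotate b c a, orient_rotate a b c] at n3
  have hsum : orient b c y * orient a b c + orient c a y * orient a b c +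
      orient a b y * orient a b c = orient a b c * orient a b c := by
    rw [← add_mul, ← add_mul, orient_sum]
  linarith [mul_self_pos.2 ho]

end Local

variable {A : Finset Plane} {P : Set (Finset (Finset Plane))}

/-! ### Maximality empties the white triangles -/

lemma card_inter_of_mem {I J : Finset Plane} (hI : I.card = 2) (hJ : J.card = 2) {y : Plane}
    (hyI : y ∈ I) (hyJ : y ∈ J) (hIJ : I ≠ J) : (I ∩ J).card = 1 := by
  have h1 : 0 < (I ∩ J).card := Finset.card_pos.2 ⟨y, Finset.mem_inter.2 ⟨hyI, hyJ⟩⟩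
  have h2 : (I ∩ J).card < I.card := by
    apply Finset.card_lt_card
    refine ⟨Finset.inter_subset_left, fun h => hIJ ?_⟩
    exact Finset.eq_of_subset_of_card_le (h.trans Finset.inter_subset_right) (by omega)
  omega

lemma image_avg_white (y a b c : Plane) :
    (white y a b c).image avg = {avg {y, a}, avg {y, b}, avg {y, c}} := by
  simp [white, Finset.image_insert]

lemma IsHypertriangulation.geometric_injOn (hP : IsHypertriangulation A 2 P) :
    Set.InjOn (fun t : Finset (Finset Plane) => t.image avg) P := by
  have aux : ∀ s ∈ P, ∀ t ∈ P, s.image avg = t.image avg → s ⊆ t := by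
    intro s hs t ht h I hI
    have : avg I ∈ t.image avg := by rw [← h]; exact Finset.mem_image_of_mem _ hI
    obtain ⟨J, hJ, hJI⟩ := Finset.mem_image.1 this
    rwa [← hP.label_unique t ht s hs J hJ I hI hJI]
  intro s hs t ht h
  exact Finset.Subset.antisymm (aux s hs t ht h) (aux t ht s hs h.symm)

/-- In a maximal level-2 hypertriangulation, a white triangle can not be subdivided further. -/
lemma IsMaximalHypertriangulation.whiteEmpty (hP : IsMaximalHypertriangulation A 2 P) :
    WhiteEmpty A P := by
  obtain ⟨hP, hmax⟩ := hP
  intro y a b c d hw hd hyd hin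
  obtain ⟨hy, ha, hb, hc, hya, hyb, hyc, hab, hac, hbc⟩ := hP.white_mem hw
  have hm : StrictlyInside (avg {y, a}) (avg {y, b}) (avg {y, c}) (avg {y, d}) := by
    unfold StrictlyInside at *
    rw [orient_avg_white hya hyb hyc, orient_avg_white hya hyb hyd, orient_avg_white hyb hyc hyd,
      orient_avg_white hyc hya hyd]
    refine ⟨?_, ?_, ?_⟩ <;> linarith
  have hs : ({avg {y, a}, avg {y, b}, avg {y, c}} : Finset Plane) ∈ geometric P :=
    ⟨_, hw, image_avg_white y a b c⟩
  -- The point `[yd]` is not yet a vertex. This makes its new label unambiguous and shows in the end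
  -- that the subdivision is proper.
  have hnot : ∀ t ∈ P, avg {y, d} ∉ t.image avg := fun t ht =>
    hP.isTriangulation.not_mem_of_strictlyInside hs hm ⟨t, ht, rfl⟩
  set N : Set (Finset (Finset Plane)) := {white y a b d, white y b c d, white y c a d} with hN
  set Q : Set (Finset (Finset Plane)) := P \ {white y a b c} ∪ N with hQ
  have hgeo : geometric Q = geometric P \ {{avg {y, a}, avg {y, b}, avg {y, c}}} ∪
      {{avg {y, a}, avg {y, b}, avg {y, d}}, {avg {y, b}, avg {y, c}, avg {y, d}},
        {avg {y, c}, avg {y, a}, avg {y, d}}} := by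
    unfold geometric
    rw [hQ, Set.image_union, hP.geometric_injOn.image_sdiff_subset (by simpa using hw)]
    simp only [hN, Set.image_insert_eq, Set.image_singleton, image_avg_white]
  have hNmem : ∀ t ∈ N, ∀ I ∈ t, ∃ x, I = {y, x} ∧ (x = a ∨ x = b ∨ x = c ∨ x = d) := by
    intro t ht I hI
    rcases ht with rfl | rfl | rfl <;>
    · simp only [white, Finset.mem_insert, Finset.mem_singleton] at hI
      rcases hI with rfl | rfl | rfl <;> exact ⟨_, rfl, by tauto⟩
  have hNsub : ∀ t ∈ N, ∀ I ∈ t, I ⊆ A ∧ I.card = 2 ∧ y ∈ I := by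
    intro t ht I hI
    obtain ⟨x, rfl, hx⟩ := hNmem t ht I hI
    refine ⟨?_, ?_, by simp⟩
    · rcases hx with rfl | rfl | rfl | rfl <;> simp [Finset.insert_subset_iff, *]
    · rcases hx with rfl | rfl | rfl | rfl <;> exact Finset.card_pair (by assumption)
  have hlab : ∀ t ∈ Q, ∀ I ∈ t, (∃ s ∈ P, I ∈ s) ∨ I = {y, d} := by
    rintro t (⟨ht, -⟩ | ht) I hI
    · exact Or.inl ⟨t, ht, hI⟩
    · obtain ⟨x, rfl, rfl | rfl | rfl | rfl⟩ := hNmem t ht I hI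
      · exact Or.inl ⟨_, hw, by simp [white]⟩
      · exact Or.inl ⟨_, hw, by simp [white]⟩
      · exact Or.inl ⟨_, hw, by simp [white]⟩
      · exact Or.inr rfl
  have hQhyp : IsHypertriangulation A 2 Q := by
    refine ⟨hP.one_le, hP.lt_card, ?_, ?_, ?_, ?_, ?_⟩
    · rintro t (⟨ht, -⟩ | ht) I hI
      · exact hP.label_subset t ht I hI
      · exact (hNsub t ht I hI).1
    · rintro t (⟨ht, -⟩ | ht) I hI
      · exact hP.label_card t ht I hI
      · exact (hNsub t ht I hI).2.1
    · intro s hs' t ht I hI J hJ hIJ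
      rcases hlab s hs' I hI with ⟨s', hs', hI'⟩ | rfl <;>
        rcases hlab t ht J hJ with ⟨t', ht', hJ'⟩ | rfl
      · exact hP.label_unique s' hs' t' ht' I hI' J hJ' hIJ
      · exact absurd (hIJ ▸ Finset.mem_image_of_mem avg hI') (hnot s' hs')
      · exact absurd (hIJ ▸ Finset.mem_image_of_mem avg hJ') (hnot t' ht')
      · rfl
    · rw [hgeo]
      exact hP.isTriangulation.subdivide hs (pair_mem_kAverages hy hd hyd) hm
    · rintro t (⟨ht, -⟩ | ht) I hI J hJ hIJ
      · exact hP.edge t ht I hI J hJ hIJ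
      · obtain ⟨-, h1, h2⟩ := hNsub t ht I hI
        obtain ⟨-, h3, h4⟩ := hNsub t ht J hJ
        rw [card_inter_of_mem h1 h3 h2 h4 hIJ]
  have hsubd : Subdivides (geometric Q) (geometric P) := by
    rw [hgeo]
    have e2 := hm.rotate.convexHull_subset
    have e3 := hm.rotate.rotate.convexHull_subset
    rintro s (⟨hs', -⟩ | rfl | rfl | rfl)
    · exact ⟨s, hs', le_rfl⟩
    · exact ⟨_, hs, by simpa using hm.convexHull_subset⟩
    · exact ⟨_, hs, by rw [← triple_rotate (avg {y, a})]; simpa using e2⟩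
    · exact ⟨_, hs, by
        rw [← triple_rotate (avg {y, a}), ← triple_rotate (avg {y, b})]; simpa using e3⟩
  have hfin := hmax Q hQhyp hsubd
  have : ({avg {y, a}, avg {y, b}, avg {y, d}} : Finset Plane) ∈ geometric P := by
    rw [← hfin, hgeo]; right; simp
  obtain ⟨t, ht, hte⟩ := this
  apply hnot t ht
  replace hte : t.image avg = _ := hte
  rw [hte]; simp

/-! ### The hypertriangulation consists of Delaunay triangles -/

lemma mem_inside_iff {S : EuclideanGeometry.Sphere Plane} {a b c : Plane} (h : orient a b c ≠ 0)
    (ha : a ∈ S) (hb : b ∈ S) (hc : c ∈ S) {x : Plane} :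
    x ∈ inside A S ↔ x ∈ A ∧ pw a b c x < 0 := by
  have hr : 0 ≤ S.radius := by
    rw [← EuclideanGeometry.mem_sphere.1 ha]; exact dist_nonneg
  rw [inside, Finset.mem_filter, ← sphere_power h ha hb hc, sub_neg, sq_lt_sq₀ dist_nonneg hr]

lemma HasLocalAngleProperty.subset_delaunay (hL : HasLocalAngleProperty 2 P)
    (hA : IsGeneric A) (hP : IsHypertriangulation A 2 P) (hE : WhiteEmpty A P) :
    P ⊆ delaunay A 2 := by
  intro t ht
  rcases hP.black_or_white ht with ⟨a, b, c, rfl⟩ | ⟨y, a, b, c, rfl⟩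
  · obtain ⟨ha, hb, hc, hab, hac, hbc⟩ := hP.black_mem ht
    have ho := hA.orient_ne_zero ha hb hc hab hac hbc
    obtain ⟨S, hSa, hSb, hSc, -⟩ := exists_sphere ho
    have hin : inside A S = ∅ := by
      ext x
      rw [mem_inside_iff ho hSa hSb hSc]
      simp only [Finset.notMem_empty, iff_false, not_and, not_lt]
      exact fun hx => hL.pw_nonneg hA hP hE hx (Or.inl ht)
    exact ⟨a, ha, b, hb, c, hc, hab, hac, hbc, S, hSa, hSb, hSc, Or.inl (by simp [hin, black])⟩
  · obtain ⟨hy, ha, hb, hc, hya, hyb, hyc, hab, hac, hbc⟩ := hP.white_mem ht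
    have ho := hA.orient_ne_zero ha hb hc hab hac hbc
    obtain ⟨S, hSa, hSb, hSc, -⟩ := exists_sphere ho
    have hin : inside A S = {y} := by
      ext x
      rw [mem_inside_iff ho hSa hSb hSc, Finset.mem_singleton]
      constructor
      · rintro ⟨hx, hlt⟩
        by_contra hne
        exact absurd (hL.pw_nonneg hA hP hE hx (Or.inr ⟨y, ht, Ne.symm hne⟩)) (not_le.2 hlt)
      · rintro rfl
        exact ⟨hy, hL.pw_center_neg hA hP ht⟩
    exact ⟨a, ha, b, hb, c, hc, hab, hac, hbc, S, hSa, hSb, hSc,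
      Or.inr (by simp [hin, white, Finset.singleton_union])⟩

/-! ### Lifting: Delaunay triangles do not overlap -/

/-- The paraboloid lifting of the label `I`, up to a linear function. -/
def lift (u v : ℝ) (I : Finset Plane) : ℝ := ∑ x ∈ I, (x 0 ^ 2 + x 1 ^ 2 + u * x 0 + v * x 1)

lemma lift_pair (u v : ℝ) {a b : Plane} (h : a ≠ b) : lift u v {a, b} =
    (a 0 ^ 2 + a 1 ^ 2 + u * a 0 + v * a 1) + (b 0 ^ 2 + b 1 ^ 2 + u * b 0 + v * b 1) :=
  Finset.sum_pair h

/-- Changing `u` and `v` adds a linear function of the point `[I]` alone, so `lift u v I` is the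
height of the lifted point over a plane, up to a constant. -/
lemma lift_eq (u v : ℝ) {I : Finset Plane} (hI : I.card = 2) :
    lift u v I = lift 0 0 I + 2 * u * avg I 0 + 2 * v * avg I 1 := by
  obtain ⟨a, b, hab, rfl⟩ := Finset.card_eq_two.1 hI
  rw [lift_pair _ _ hab, lift_pair _ _ hab, avg_pair hab]
  simp only [PiLp.add_apply, PiLp.smul_apply, smul_eq_mul]; ring

lemma pair_left_inj {y a b : Plane} : ({y, a} : Finset Plane) = {y, b} ↔ a = b := by
  constructor
  · intro h
    have h1 : a ∈ ({y, b} : Finset Plane) := by rw [← h]; simp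
    have h2 : b ∈ ({y, a} : Finset Plane) := by rw [h]; simp
    simp only [Finset.mem_insert, Finset.mem_singleton] at h1 h2
    rcases h1 with rfl | h1
    · rcases h2 with h2 | h2 <;> exact h2.symm
    · exact h1
  · rintro rfl; rfl

lemma pair_mem_white {y a b c x : Plane} : {y, x} ∈ white y a b c ↔ x = a ∨ x = b ∨ x = c := by
  simp [white, pair_left_inj]

lemma mem_of_mem_white {y a b c : Plane} {I : Finset Plane} (h : I ∈ white y a b c) : y ∈ I := by
  simp only [white, Finset.mem_insert, Finset.mem_singleton] at h
  rcases h with rfl | rfl | rfl <;> simp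

lemma pair_mem_black {a b c x z : Plane} (hxz : x ≠ z) : {x, z} ∈ black a b c ↔
    (x = a ∨ x = b ∨ x = c) ∧ (z = a ∨ z = b ∨ z = c) := by
  constructor
  · intro h
    have hx : x ∈ ({x, z} : Finset Plane) := by simp
    have hz : z ∈ ({x, z} : Finset Plane) := by simp
    simp only [black, Finset.mem_insert, Finset.mem_singleton] at h
    rcases h with h | h | h <;> rw [h] at hx hz <;>
      simp only [Finset.mem_insert, Finset.mem_singleton] at hx hz <;> tauto
  · rintro ⟨rfl | rfl | rfl, rfl | rfl | rfl⟩ <;> simp [black, Finset.pair_comm] at hxz ⊢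

/-- The triangles of the order-2 Delaunay triangulation lift to faces of the lower convex hull. -/
lemma delaunay_support (hA : IsGeneric A) {t : Finset (Finset Plane)} (ht : t ∈ delaunay A 2) :
    t.card = 3 ∧ (∀ I ∈ t, I ⊆ A ∧ I.card = 2) ∧ ∃ u v κ : ℝ, ∀ I ⊆ A, I.card = 2 →
      κ ≤ lift u v I ∧ (lift u v I = κ ↔ I ∈ t) := by
  obtain ⟨a, ha, b, hb, c, hc, hab, hac, hbc, S, hSa, hSb, hSc, h⟩ := ht
  have ho := hA.orient_ne_zero ha hb hc hab hac hbc
  set k : ℝ := S.center 0 ^ 2 + S.center 1 ^ 2 - S.radius ^ 2 with hk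
  have hF : ∀ x : Plane, x 0 ^ 2 + x 1 ^ 2 + -2 * S.center 0 * x 0 + -2 * S.center 1 * x 1 =
      pw a b c x - k := by
    intro x
    rw [← sphere_power ho hSa hSb hSc, dist_sq]; ring
  have hF0 : ∀ x ∈ A, (pw a b c x = 0 ↔ x = a ∨ x = b ∨ x = c) := by
    intro x hx
    constructor
    · intro h
      by_contra! hne
      exact hA.pw_ne_zero ha hb hc hx hab hac hne.1.symm hbc hne.2.1.symm hne.2.2.symm h
    · rintro (rfl | rfl | rfl)
      · simp
      · simp
      · exact pw_last ho
  rcases h with ⟨hcard, rfl⟩ | ⟨hcard, rfl⟩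
  · have hin : inside A S = ∅ := by
      rw [← Finset.card_eq_zero]; omega
    have hpos : ∀ x ∈ A, 0 ≤ pw a b c x := by
      intro x hx
      by_contra! h
      have := (mem_inside_iff ho hSa hSb hSc).2 ⟨hx, h⟩
      simp [hin] at this
    simp only [hin, Finset.empty_union]
    -- With these coefficients `lift` is the sum of the two powers minus `2 * k`. All powers are
    -- nonnegative and vanish only at `a`, `b`, `c`.
    refine ⟨?_, ?_, -2 * S.center 0, -2 * S.center 1, -2 * k, ?_⟩
    · refine Finset.card_eq_three.2 ⟨_, _, _, ?_, ?_, ?_, rfl⟩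
      · rwa [ne_eq, pair_left_inj]
      · rwa [Finset.pair_comm, ne_eq, pair_left_inj]
      · rwa [Finset.pair_comm, Finset.pair_comm b, ne_eq, pair_left_inj]
    · intro I hI
      simp only [Finset.mem_insert, Finset.mem_singleton] at hI
      rcases hI with rfl | rfl | rfl <;>
        exact ⟨by simp [Finset.insert_subset_iff, *], Finset.card_pair (by assumption)⟩
    · intro I hIA hI
      obtain ⟨x, z, hxz, rfl⟩ := Finset.card_eq_two.1 hI
      have hx : x ∈ A := hIA (by simp)
      have hz : z ∈ A := hIA (by simp)
      rw [lift_pair _ _ hxz, hF, hF]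
      have h1 := hpos x hx
      have h2 := hpos z hz
      refine ⟨by linarith, ?_⟩
      change _ ↔ _ ∈ black a b c
      rw [pair_mem_black hxz, ← hF0 x hx, ← hF0 z hz]
      constructor
      · intro h; constructor <;> linarith
      · rintro ⟨h, h'⟩; linarith
  · obtain ⟨y, hin⟩ : ∃ y, inside A S = {y} := by
      rw [← Finset.card_eq_one]; omega
    have hy := (mem_inside_iff ho hSa hSb hSc).1 (show y ∈ inside A S by simp [hin])
    have hpos : ∀ x ∈ A, x ≠ y → 0 ≤ pw a b c x := by
      intro x hx hne
      by_contra! h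
      have := (mem_inside_iff ho hSa hSb hSc).2 ⟨hx, h⟩
      simp [hin, hne] at this
    obtain ⟨hyA, hy⟩ := hy
    have hya : y ≠ a := by rintro rfl; simp at hy
    have hyb : y ≠ b := by rintro rfl; simp at hy
    have hyc : y ≠ c := by rintro rfl; simp [pw_last ho] at hy
    simp only [hin, Finset.singleton_union]
    -- Only `y` has negative power, so the least sum of two powers is attained exactly by `y` with
    -- one of `a`, `b`, `c`.
    refine ⟨?_, ?_, -2 * S.center 0, -2 * S.center 1, pw a b c y - 2 * k, ?_⟩
    · refine Finset.card_eq_three.2 ⟨_, _, _, ?_, ?_, ?_, rfl⟩ <;> rwa [ne_eq, pair_left_inj]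
    · intro I hI
      simp only [Finset.mem_insert, Finset.mem_singleton] at hI
      rcases hI with rfl | rfl | rfl <;>
        exact ⟨by simp [Finset.insert_subset_iff, *], Finset.card_pair (by assumption)⟩
    · intro I hIA hI
      change _ ∧ (_ ↔ _ ∈ white y a b c)
      by_cases hyI : y ∈ I
      · obtain ⟨x, hyx, rfl⟩ := exists_eq_pair hI hyI
        have hx : x ∈ A := hIA (by simp)
        rw [lift_pair _ _ hyx, hF, hF, pair_mem_white, ← hF0 x hx]
        have h1 := hpos x hx hyx.symm
        refine ⟨by linarith, ?_⟩
        constructor <;> intro h <;> linarith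
      · obtain ⟨x, z, hxz, rfl⟩ := Finset.card_eq_two.1 hI
        have h1 := hpos x (hIA (by simp)) (by rintro rfl; simp at hyI)
        have h2 := hpos z (hIA (by simp)) (by rintro rfl; simp at hyI)
        rw [lift_pair _ _ hxz, hF, hF]
        refine ⟨by linarith, fun h => by linarith, fun h => absurd (mem_of_mem_white h) hyI⟩

/-- Triangles of the order-2 Delaunay triangulation do not overlap. -/
lemma delaunay_eq_of_centroid_mem (hA : IsGeneric A) {I₁ I₂ I₃ : Finset Plane}
    {s : Finset (Finset Plane)} (ht : {I₁, I₂, I₃} ∈ delaunay A 2) (hs : s ∈ delaunay A 2)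
    (h : (1 / 3 : ℝ) • avg I₁ + (1 / 3 : ℝ) • avg I₂ + (1 / 3 : ℝ) • avg I₃ ∈
      convexHull ℝ ((s.image avg : Finset Plane) : Set Plane)) : {I₁, I₂, I₃} = s := by
  obtain ⟨ht3, htA, u, v, κ, ht⟩ := delaunay_support hA ht
  obtain ⟨hs3, hsA, u', v', κ', hs⟩ := delaunay_support hA hs
  obtain ⟨J₁, J₂, J₃, -, -, -, rfl⟩ := Finset.card_eq_three.1 hs3
  simp only [Finset.image_insert, Finset.image_singleton, Finset.coe_insert,
    Finset.coe_singleton] at h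
  obtain ⟨α, β, γ, hα, hβ, hγ, hsum, hp⟩ := mem_convexHull_triple.1 h
  have hp0 := congrArg (fun q : Plane => q 0) hp
  have hp1 := congrArg (fun q : Plane => q 1) hp
  simp only [PiLp.add_apply, PiLp.smul_apply, smul_eq_mul] at hp0 hp1
  simp only [Finset.mem_insert, Finset.mem_singleton, forall_eq_or_imp, forall_eq] at htA hsA
  obtain ⟨⟨a1, b1⟩, ⟨a2, b2⟩, a3, b3⟩ := htA
  obtain ⟨⟨c1, d1⟩, ⟨c2, d2⟩, c3, d3⟩ := hsA
  have e1 := (ht I₁ a1 b1).2.2 (by simp)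
  have e2 := (ht I₂ a2 b2).2.2 (by simp)
  have e3 := (ht I₃ a3 b3).2.2 (by simp)
  have f1 := (hs J₁ c1 d1).2.2 (by simp)
  have f2 := (hs J₂ c2 d2).2.2 (by simp)
  have f3 := (hs J₃ c3 d3).2.2 (by simp)
  have g1 := mul_nonneg hα (sub_nonneg.2 (ht J₁ c1 d1).1)
  have g2 := mul_nonneg hβ (sub_nonneg.2 (ht J₂ c2 d2).1)
  have g3 := mul_nonneg hγ (sub_nonneg.2 (ht J₃ c3 d3).1)
  have k1 := (hs I₁ a1 b1).1
  have k2 := (hs I₂ a2 b2).1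
  have k3 := (hs I₃ a3 b3).1
  -- At the centroid the lifted triangle `t` is no higher than the lifted `s`, because the plane of
  -- `t` supports all lifted points from below. The supporting plane of `s` gives the reverse bound,
  -- so all three lifted points of `t` lie on it.
  have key : lift u' v' I₁ - κ' + (lift u' v' I₂ - κ') + (lift u' v' I₃ - κ') ≤ 0 := by
    rw [lift_eq u v b1] at e1
    rw [lift_eq u v b2] at e2
    rw [lift_eq u v b3] at e3
    rw [lift_eq u' v' d1] at f1
    rw [lift_eq u' v' d2] at f2
    rw [lift_eq u' v' d3] at f3
    rw [lift_eq u v d1] at g1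
    rw [lift_eq u v d2] at g2
    rw [lift_eq u v d3] at g3
    rw [lift_eq u' v' b1, lift_eq u' v' b2, lift_eq u' v' b3]
    have q1 : lift 0 0 I₁ + lift 0 0 I₂ + lift 0 0 I₃ ≤
        3 * (α * lift 0 0 J₁ + β * lift 0 0 J₂ + γ * lift 0 0 J₃) := by
      linear_combination e1 + e2 + e3 + 3 * g1 + 3 * g2 + 3 * g3 - 6 * u * hp0 - 6 * v * hp1 -
        3 * κ * hsum
    linear_combination q1 + 3 * α * f1 + 3 * β * f2 + 3 * γ * f3 + 6 * u' * hp0 + 6 * v' * hp1 +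
      3 * κ' * hsum
  apply Finset.eq_of_subset_of_card_le
  · intro I hI
    simp only [Finset.mem_insert, Finset.mem_singleton] at hI
    rcases hI with rfl | rfl | rfl
    · exact (hs I a1 b1).2.1 (by linarith)
    · exact (hs I a2 b2).2.1 (by linarith)
    · exact (hs I a3 b3).2.1 (by linarith)
  · omega

lemma IsHypertriangulation.eq_delaunay_of_subset (hA : IsGeneric A)
    (hP : IsHypertriangulation A 2 P) (hsub : P ⊆ delaunay A 2) : P = delaunay A 2 := by
  refine Set.Subset.antisymm hsub fun t ht => ?_
  obtain ⟨ht3, htA, -⟩ := delaunay_support hA ht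
  obtain ⟨I₁, I₂, I₃, -, -, -, rfl⟩ := Finset.card_eq_three.1 ht3
  have hmem : (1 / 3 : ℝ) • avg I₁ + (1 / 3 : ℝ) • avg I₂ + (1 / 3 : ℝ) • avg I₃ ∈
      convexHull ℝ (kAverages A 2) := by
    apply convexHull_mono (s := {avg I₁, avg I₂, avg I₃})
    · rintro x (rfl | rfl | rfl)
      · exact ⟨I₁, (htA _ (by simp)).1, (htA _ (by simp)).2, rfl⟩
      · exact ⟨I₂, (htA _ (by simp)).1, (htA _ (by simp)).2, rfl⟩
      · exact ⟨I₃, (htA _ (by simp)).1, (htA _ (by simp)).2, rfl⟩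
    · exact mem_convexHull_triple.2 ⟨1 / 3, 1 / 3, 1 / 3, by norm_num, by norm_num, by norm_num,
        by norm_num, rfl⟩
  rw [← hP.isTriangulation.cover] at hmem
  simp only [Set.mem_iUnion] at hmem
  obtain ⟨_, ⟨s, hs, rfl⟩, hps⟩ := hmem
  rw [delaunay_eq_of_centroid_mem hA ht (hsub hs) hps]
  exact hs

/-! ### The Delaunay triangulation has the local angle property -/

/-- Membership in `delaunay` only provides some names for the labels of the triangle. The supporting
plane depends on the set of labels alone, so the signs are recovered from it for the given names. -/
lemma pw_of_white_mem_delaunay (hA : IsGeneric A) {y a b c : Plane}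
    (h : white y a b c ∈ delaunay A 2) (hy : y ∈ A) (ha : a ∈ A) (hb : b ∈ A) (hc : c ∈ A)
    (hya : y ≠ a) (hyb : y ≠ b) (hyc : y ≠ c) (hab : a ≠ b) (hac : a ≠ c) (hbc : b ≠ c) :
    pw a b c y < 0 ∧ ∀ d ∈ A, y ≠ d → a ≠ d → b ≠ d → c ≠ d → 0 < pw a b c d := by
  obtain ⟨-, -, u, v, κ, hG⟩ := delaunay_support hA h
  have ho := hA.orient_ne_zero ha hb hc hab hac hbc
  have hsub : ∀ x z, x ∈ A → z ∈ A → ({x, z} : Finset Plane) ⊆ A := fun x z hx hz => by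
    simp [Finset.insert_subset_iff, hx, hz]
  have e1 := (hG {y, a} (hsub _ _ hy ha) (Finset.card_pair hya)).2.2 (by simp [white])
  have e2 := (hG {y, b} (hsub _ _ hy hb) (Finset.card_pair hyb)).2.2 (by simp [white])
  have e3 := (hG {y, c} (hsub _ _ hy hc) (Finset.card_pair hyc)).2.2 (by simp [white])
  rw [lift_pair _ _ (by assumption)] at e1 e2 e3
  -- The constant that makes the quadratic vanish at `a`, `b` and `c`, hence equal to the power.
  set w := y 0 ^ 2 + y 1 ^ 2 + u * y 0 + v * y 1 - κ with hw
  have hpw := eq_pw_of_eq_zero ho (u := u) (v := v) (w := w) (by linarith) (by linarith)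
    (by linarith)
  constructor
  -- The label `{a, b}` omits `y`, so it lies strictly above the supporting plane; this is exactly
  -- negativity of the power of `y`.
  · obtain ⟨h1, h2⟩ := hG {a, b} (hsub _ _ ha hb) (Finset.card_pair hab)
    have h3 : lift u v {a, b} ≠ κ := fun h => by
      have := mem_of_mem_white (h2.1 h)
      simp only [Finset.mem_insert, Finset.mem_singleton] at this
      tauto
    have h4 := lt_of_le_of_ne h1 h3.symm
    rw [lift_pair _ _ hab] at h4
    rw [← hpw]; linarith
  · intro d hd hyd had hbd hcd
    obtain ⟨h1, h2⟩ := hG {y, d} (hsub _ _ hy hd) (Finset.card_pair hyd)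
    have h3 : lift u v {y, d} ≠ κ := fun h => by
      have := pair_mem_white.1 (h2.1 h)
      tauto
    have h4 := lt_of_le_of_ne h1 h3.symm
    rw [lift_pair _ _ hyd] at h4
    rw [← hpw]; linarith

lemma pw_of_black_mem_delaunay (hA : IsGeneric A) {a b c : Plane}
    (h : black a b c ∈ delaunay A 2) (ha : a ∈ A) (hb : b ∈ A) (hc : c ∈ A)
    (hab : a ≠ b) (hac : a ≠ c) (hbc : b ≠ c) {d : Plane} (hd : d ∈ A) (had : a ≠ d) (hbd : b ≠ d)
    (hcd : c ≠ d) : 0 < pw a b c d := by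
  obtain ⟨-, -, u, v, κ, hG⟩ := delaunay_support hA h
  have ho := hA.orient_ne_zero ha hb hc hab hac hbc
  have hsub : ∀ x z, x ∈ A → z ∈ A → ({x, z} : Finset Plane) ⊆ A := fun x z hx hz => by
    simp [Finset.insert_subset_iff, hx, hz]
  have e1 := (hG {a, b} (hsub _ _ ha hb) (Finset.card_pair hab)).2.2 (by simp [black])
  have e2 := (hG {a, c} (hsub _ _ ha hc) (Finset.card_pair hac)).2.2 (by simp [black])
  have e3 := (hG {b, c} (hsub _ _ hb hc) (Finset.card_pair hbc)).2.2 (by simp [black])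
  rw [lift_pair _ _ (by assumption)] at e1 e2 e3
  -- The three pairwise sums all equal `κ`, so the quadratic takes the value `κ / 2` at each of `a`,
  -- `b`, `c`.
  have hpw := eq_pw_of_eq_zero ho (u := u) (v := v) (w := -(κ / 2)) (by linarith) (by linarith)
    (by linarith)
  obtain ⟨h1, h2⟩ := hG {a, d} (hsub _ _ ha hd) (Finset.card_pair had)
  have h3 : lift u v {a, d} ≠ κ := fun h => by
    have := (pair_mem_black had).1 (h2.1 h)
    tauto
  have h4 := lt_of_le_of_ne h1 h3.symm
  rw [lift_pair _ _ had] at h4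
  rw [← hpw]; linarith

lemma IsWhite.exists_eq_of_mem (hP : IsHypertriangulation A 2 P) {I J K : Finset Plane}
    (ht : {I, J, K} ∈ P) {y a b : Plane} (hI : I = {y, a}) (hJ : J = {y, b}) (hab : a ≠ b)
    (hw : IsWhite 2 I J K) : ∃ c, K = {y, c} := by
  have hy : I ∩ J = {y} := by
    subst hI hJ
    ext x; simp only [Finset.mem_inter, Finset.mem_insert, Finset.mem_singleton]
    constructor
    · rintro ⟨h | h, h' | h'⟩
      · exact h
      · exact h
      · exact h'
      · exact absurd (h.symm.trans h') hab
    · tauto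
  unfold IsWhite at hw
  rw [hy] at hw
  have : ({y} ∩ K : Finset Plane).Nonempty := by rw [← Finset.card_pos]; omega
  obtain ⟨x, hx⟩ := this
  simp only [Finset.mem_inter, Finset.mem_singleton] at hx
  obtain ⟨rfl, hx⟩ := hx
  obtain ⟨c, -, hc⟩ := exists_eq_pair (hP.label_card _ ht K (by simp)) hx
  exact ⟨c, hc⟩

lemma exists_edge_of_mem (hP : IsHypertriangulation A 2 P) {I J K : Finset Plane}
    (ht : {I, J, K} ∈ P) : ∃ y a b, I = {y, a} ∧ J = {y, b} ∧ a ≠ b := by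
  refine hP.exists_edge ht (by simp) (by simp) ?_
  rintro rfl
  have h := hP.card_eq ht
  have h2 := Finset.card_le_two (a := I) (b := K)
  rw [Finset.insert_eq_of_mem (by simp)] at h
  omega

/-- At level 2, no edge is shared by two black triangles. -/
lemma IsBlack.eq_of_mem (hP : IsHypertriangulation A 2 P) {I J K : Finset Plane}
    (ht : {I, J, K} ∈ P) {y a b : Plane} (hI : I = {y, a}) (hJ : J = {y, b}) (hab : a ≠ b)
    (hb : IsBlack 2 I J K) : K = {a, b} := by
  obtain ⟨-, -, hya⟩ := hP.ne_of_pair_mem ht (a := y) (b := a) (by simp [hI])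
  have hyK : y ∉ K := by
    intro hy
    have : y ∈ I ∩ J ∩ K := by simp [hI, hJ, hy]
    have := Finset.card_pos.2 ⟨y, this⟩
    unfold IsBlack at hb
    omega
  subst hI hJ
  have hK : K ∈ ({{y, a}, {y, b}, K} : Finset (Finset Plane)) := by simp
  rcases hP.classify ht (y := y) (a := a) (b := b) (by simp) (by simp) hab with h | ⟨c, h⟩
  · rw [h, black] at hK
    simp only [Finset.mem_insert, Finset.mem_singleton] at hK
    rcases hK with rfl | rfl | h
    · simp at hyK
    · simp at hyK
    · exact h
  · rw [h] at hK
    exact absurd (mem_of_mem_white hK) hyK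

/-- The order-2 Delaunay triangulation has the local angle property. -/
lemma IsHypertriangulation.hasLocalAngleProperty (hA : IsGeneric A)
    (hP : IsHypertriangulation A 2 P) (hD : P = delaunay A 2) : HasLocalAngleProperty 2 P := by
  refine ⟨?_, ?_, ?_⟩
  · intro I J K L hK hL hKL hwK hwL
    obtain ⟨y, a, b, hI, hJ, hab⟩ := exists_edge_of_mem hP hK
    obtain ⟨c, rfl⟩ := IsWhite.exists_eq_of_mem hP hK hI hJ hab hwK
    obtain ⟨d, rfl⟩ := IsWhite.exists_eq_of_mem hP hL hI hJ hab hwL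
    subst hI hJ
    have hcd : c ≠ d := fun h => hKL (by rw [h])
    obtain ⟨hyA, haA, hbA, hcA, hya, hyb, hyc, -, hac, hbc⟩ := hP.white_mem hK
    obtain ⟨-, -, -, hdA, -, -, hyd, -, had, hbd⟩ := hP.white_mem hL
    have h1 := (pw_of_white_mem_delaunay hA (hD ▸ hK) hyA haA hbA hcA hya hyb hyc hab hac hbc).2
      d hdA hyd had hbd hcd
    have h2 := (pw_of_white_mem_delaunay hA (hD ▸ hL) hyA haA hbA hdA hya hyb hyd hab had hbd).2
      c hcA hyc hac hbc hcd.symm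
    have hoc := hA.orient_ne_zero haA hbA hcA hab hac hbc
    have hod := hA.orient_ne_zero haA hbA hdA hab had hbd
    rw [oppositeAngle_white hya hyb hyc, oppositeAngle_white hya hyb hyd,
      angle_add_le_pi_iff hoc hod]
    have h3 := pw_mul hoc d
    have h4 := pw_mul hod c
    -- Apexes on the same side of `ab` are impossible: `h3` and `h4` sum to zero, so `c` and `d`
    -- cannot both be outside each other's circle. Opposite sides give the inequality.
    rcases lt_or_gt_of_ne hoc with h5 | h5 <;> rcases lt_or_gt_of_ne hod with h6 | h6
    · linarith [mul_neg_of_neg_of_pos h5 h1, mul_neg_of_neg_of_pos h6 h2]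
    · rw [abs_of_neg h5, abs_of_pos h6]
      linarith [mul_neg_of_neg_of_pos h5 h1]
    · rw [abs_of_pos h5, abs_of_neg h6]
      linarith [mul_pos h5 h1]
    · linarith [mul_pos h5 h1, mul_pos h6 h2]
  · intro I J K L hK hL hKL hbK hbL
    obtain ⟨y, a, b, hI, hJ, hab⟩ := exists_edge_of_mem hP hK
    exact absurd ((IsBlack.eq_of_mem hP hK hI hJ hab hbK).trans
      (IsBlack.eq_of_mem hP hL hI hJ hab hbL).symm) hKL
  · intro I J K L hK hL hbK hwL
    obtain ⟨y, a, b, hI, hJ, hab⟩ := exists_edge_of_mem hP hK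
    obtain rfl := IsBlack.eq_of_mem hP hK hI hJ hab hbK
    obtain ⟨d, rfl⟩ := IsWhite.exists_eq_of_mem hP hL hI hJ hab hwL
    subst hI hJ
    obtain ⟨hyA, haA, hbA, hdA, hya, hyb, hyd, -, had, hbd⟩ := hP.white_mem hL
    have h1 := pw_of_black_mem_delaunay hA (hD ▸ hK) hyA haA hbA hya hyb hab hdA hyd had hbd
    have h2 := (pw_of_white_mem_delaunay hA (hD ▸ hL) hyA haA hbA hdA hya hyb hyd hab had hbd).1
    have hoy := hA.orient_ne_zero haA hbA hyA hab hya.symm hyb.symm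
    have hod := hA.orient_ne_zero haA hbA hdA hab had hbd
    rw [← pw_rotate (by rwa [orient_rotate] at hoy)] at h1
    rw [oppositeAngle_white hya hyb hyd, oppositeAngle_black hya hyb hab,
      angle_lt_angle_iff hoy hod]
    have h3 := pw_mul hoy d
    have h4 := pw_mul hod y
    -- Here the opposite-side cases are contradictory, as `d` is outside the circle `aby` and `y` is
    -- inside the circle `abd`.
    rcases lt_or_gt_of_ne hoy with h5 | h5 <;> rcases lt_or_gt_of_ne hod with h6 | h6
    · rw [abs_of_neg h5, abs_of_neg h6]
      linarith [mul_neg_of_neg_of_pos h5 h1]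
    · linarith [mul_neg_of_neg_of_pos h5 h1, mul_neg_of_pos_of_neg h6 h2]
    · linarith [mul_pos h5 h1, mul_pos_of_neg_of_neg h6 h2]
    · rw [abs_of_pos h5, abs_of_pos h6]
      linarith [mul_pos h5 h1]

end Hypertri
end

theorem mainTheorem2 (A : Finset Hypertri.Plane) (hA : Hypertri.IsGeneric A)
    (P : Set (Finset (Finset Hypertri.Plane)))
    (hP : Hypertri.IsMaximalHypertriangulation A 2 P) :
    Hypertri.HasLocalAngleProperty 2 P ↔ P = Hypertri.delaunay A 2 :=
  ⟨fun hL => hP.1.eq_delaunay_of_subset hA (hL.subset_delaunay hA hP.1 hP.whiteEmpty),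
    fun hD => hP.1.hasLocalAngleProperty hA hD⟩
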